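/- **Setting.** There are $L$ queues and a finite set $\mathcal S\subset\mathbb Z_{\ge 0}^L$ of feasible service vectors with $0\in\mathcal S$. The capacity region is $\mathcal R=\mathrm{conv}(\mathcal S)$, and it is assumed to have the form $\mathcal R=\{r\succeq 0:\langle c^{(k)},r\rangle\le b^{(k)},\ k=1,\dots,K\}$ with $\|c^{(k)}\|=1$, $c^{(k)}\succeq 0$, $b^{(k)}>0$, where the description is minimal (no hyperplane can be dropped). Let $\mathcal H^{(k)}=\{r:\langle c^{(k)},r\rangle=b^{(k)}\}$ and $\mathcal F^{(k)}=\mathcal H^{(k)}\cap\mathcal R$. The arrivals $A_l[t]$ are independent over queues $l$ and i.i.d. over slots $t$, integer-valued in $[0,A_{\max}]$, with mean vector $\lambda$ and variances $\sigma_l^2$; $\mathcal S$ and $A_{\max}$ are fixed. Queues evolve by $Q[t+1]=(Q[t]+A[t]-S[t])^+$, componentwise, with $S[t]\in\mathcal S$. MaxWeight draws $S[t]$ uniformly from $\arg\max_{s\in\mathcal S}\langle Q[t],s\rangle$, independently of the current arrivals. A steady state $\overline Q$ of MaxWeight is any limit in distribution of $Q[t]$, for some initial law (for instance, any stationary law of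 the chain). A steady state of a feasible policy is, likewise, a limit in distribution of $Q[t]$ when the $S[t]\in\mathcal S$ are chosen in any way. For $\lambda\in\mathrm{Int}(\mathcal R)$ put $\epsilon^{(k)}=\mathrm{dist}(\lambda,\mathcal H^{(k)})$, $\lambda^{(k)}=\lambda+\epsilon^{(k)}c^{(k)}$ and $\zeta^{(\epsilon,k)}=\sum_l (c^{(k)}_l)^2\sigma_l^2$. **Statement.** For every arrival process with $\lambda\in\mathrm{Int}(\mathcal R)$, a steady state of MaxWeight exists. Fix $k$ and a compact set $C\subset\mathrm{Relint}(\mathcal F^{(k)})$, for example a single point. 1. There is a function $B\ge 0$ with $\lim_{\epsilon\downarrow0}\epsilon B(\epsilon)=0$ (depending only on the data fixed so far) such that, for all arrival processes with $\lambda\in\mathrm{Int}(\mathcal R)$ and $\lambda^{(k)}\in C$, every MaxWeight steady state satisfies $$\mathbb E\langle c^{(k)},\overline Q\rangle\le\frac{\zeta^{(\epsilon,k)}}{2\epsilon^{(k)}}+B(\epsilon^{(k)}).$$ 2. Consider a sequence of arrival processes with $\lambda\in\mathrm{Int}(\mathcal R)$ and $\lambda^{(k)}\in C$ along the sequence, $\epsilon^{(k)}\to0$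 and $(\sigma_l^2)_l\to(v_l)_l$ (if $C$ is a single point, $\lambda$ approaches the face along its normal), and put $\zeta^{(k)}=\sum_l(c^{(k)}_l)^2v_l$. Then for all choices of MaxWeight steady states $$\limsup\ \epsilon^{(k)}\,\mathbb E\langle c^{(k)},\overline Q\rangle\le\frac{\zeta^{(k)}}2,$$ while for all choices of steady states of feasible policies $$\liminf\ \epsilon^{(k)}\,\mathbb E\langle c^{(k)},\overline Q\rangle\ge\frac{\zeta^{(k)}}2.$$ In particular, under MaxWeight $\epsilon^{(k)}\,\mathbb E\langle c^{(k)},\overline Q\rangle\to\zeta^{(k)}/2$, the least value possible under any feasible policy: MaxWeight is first-moment heavy-traffic optimal. -/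

import Mathlib

open MeasureTheory ProbabilityTheory Filter Topology
open scoped NNReal ENNReal

noncomputable section

namespace MaxWeight

variable {L K : ℕ}

/-! ## Capacity region of the scheduling problem -/

/-- An integer vector, seen as a point of Euclidean space. -/
def toVec (s : Fin L → ℕ) : EuclideanSpace ℝ (Fin L) :=
  WithLp.toLp 2 fun l => (s l : ℝ)

/-- The capacity region: the convex hull of the finite set `𝒮` of feasible service vectors. -/
def capacityRegion (𝒮 : Finset (Fin L → ℕ)) : Set (EuclideanSpace ℝ (Fin L)) :=
  convexHull ℝ (toVec '' (𝒮 : Set (Fin L → ℕ)))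

/-- The hyperplane `{r : ⟨c, r⟩ = b}`. -/
def hyperplane (c : EuclideanSpace ℝ (Fin L)) (b : ℝ) : Set (EuclideanSpace ℝ (Fin L)) :=
  {r | inner ℝ c r = b}

/-- The polyhedron `{r ⪰ 0 : ⟨c j, r⟩ ≤ b j for the indices j in J}`. -/
def polyhedron (c : Fin K → EuclideanSpace ℝ (Fin L)) (b : Fin K → ℝ) (J : Set (Fin K)) :
    Set (EuclideanSpace ℝ (Fin L)) :=
  {r | (∀ l, 0 ≤ r l) ∧ ∀ j ∈ J, inner ℝ (c j) r ≤ b j}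

/-- `(c k, b k)`, `k : Fin K`, is a minimal hyperplane description of the capacity region, with
unit, componentwise nonnegative normals and positive offsets.  Minimality says that no
hyperplane can be dropped. -/
structure IsMinimalDescription (𝒮 : Finset (Fin L → ℕ))
    (c : Fin K → EuclideanSpace ℝ (Fin L)) (b : Fin K → ℝ) : Prop where
  norm_eq_one : ∀ k, ‖c k‖ = 1
  nonneg : ∀ k l, 0 ≤ c k l
  offset_pos : ∀ k, 0 < b k
  region_eq : capacityRegion 𝒮 = polyhedron c b Set.univ
  minimal : ∀ k, polyhedron c b {k}ᶜ ≠ capacityRegion 𝒮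

/-- The face cut out of the capacity region by the hyperplane `{r : ⟨c, r⟩ = b}`. -/
def face (𝒮 : Finset (Fin L → ℕ)) (c : EuclideanSpace ℝ (Fin L)) (b : ℝ) :
    Set (EuclideanSpace ℝ (Fin L)) :=
  hyperplane c b ∩ capacityRegion 𝒮

/-! ## Arrivals

In every slot the arrivals to queue `l` have law `α l`; arrivals are independent over queues and
over slots. -/

/-- The arrivals to each queue are bounded by `Amax`. -/
def BoundedArrivals (α : Fin L → PMF ℕ) (Amax : ℕ) : Prop :=
  ∀ l, ∀ n ∈ (α l).support, n ≤ Amax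

/-- Joint law of the arrival vector of one slot: the product of the laws `α l`. -/
def arrivalLaw (α : Fin L → PMF ℕ) : PMF (Fin L → ℕ) :=
  (Measure.pi fun l => (α l).toMeasure).toPMF

/-- The vector of mean arrival rates. -/
def rate (α : Fin L → PMF ℕ) : EuclideanSpace ℝ (Fin L) :=
  WithLp.toLp 2 fun l => ∫ n, (n : ℝ) ∂(α l).toMeasure

/-- The variance of the arrivals to queue `l` in one slot. -/
def arrivalVar (α : Fin L → PMF ℕ) (l : Fin L) : ℝ :=
  variance (fun n : ℕ => (n : ℝ)) (α l).toMeasure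

/-- `ζ = ∑ l, (c l)² (σ l)²`, for a vector `v` of variances `(σ l)²`. -/
def zeta (c : EuclideanSpace ℝ (Fin L)) (v : Fin L → ℝ) : ℝ :=
  ∑ l, (c l) ^ 2 * v l

/-- The distance of the arrival rate vector to the hyperplane `{r : ⟨c, r⟩ = b}`. -/
def gap (α : Fin L → PMF ℕ) (c : EuclideanSpace ℝ (Fin L)) (b : ℝ) : ℝ :=
  Metric.infDist (rate α) (hyperplane c b)

/-- The projection of the arrival rate vector to the hyperplane `{r : ⟨c, r⟩ = b}`. -/
def projection (α : Fin L → PMF ℕ) (c : EuclideanSpace ℝ (Fin L)) (b : ℝ) :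
    EuclideanSpace ℝ (Fin L) :=
  rate α + gap α c b • c

/-! ## Queue dynamics and steady states

Queue lengths evolve by `Q[t+1] = (Q[t] + A[t] - S[t])⁺`; the truncated subtraction of natural
numbers is exactly this positive part. -/

/-- The feasible service vectors that maximize the weight `⟨q, s⟩`. -/
def maxWeightSchedules (𝒮 : Finset (Fin L → ℕ)) (q : Fin L → ℕ) : Finset (Fin L → ℕ) :=
  𝒮.filter fun s => ∀ s' ∈ 𝒮, ∑ l, q l * s' l ≤ ∑ l, q l * s l

theorem maxWeightSchedules_nonempty {𝒮 : Finset (Fin L → ℕ)} (h : 𝒮.Nonempty)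
    (q : Fin L → ℕ) : (maxWeightSchedules 𝒮 q).Nonempty := by
  obtain ⟨s, hs, hmax⟩ := 𝒮.exists_max_image (fun s => ∑ l, q l * s l) h
  exact ⟨s, Finset.mem_filter.mpr ⟨hs, hmax⟩⟩

/-- One slot under MaxWeight from queue lengths `q`: a schedule is drawn uniformly from the
weight maximizers, independently of the arrivals of the slot. -/
def maxWeightStep (𝒮 : Finset (Fin L → ℕ)) (h : 𝒮.Nonempty) (α : Fin L → PMF ℕ)
    (q : Fin L → ℕ) : PMF (Fin L → ℕ) :=
  (PMF.uniformOfFinset (maxWeightSchedules 𝒮 q) (maxWeightSchedules_nonempty h q)).bind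
    fun s => (arrivalLaw α).map fun a => q + a - s

/-- The law of the queue lengths in slot `t` under MaxWeight, for the initial law `μ`. -/
def maxWeightLaw (𝒮 : Finset (Fin L → ℕ)) (h : 𝒮.Nonempty) (α : Fin L → PMF ℕ)
    (μ : PMF (Fin L → ℕ)) (t : ℕ) : PMF (Fin L → ℕ) :=
  (fun ν : PMF (Fin L → ℕ) => ν.bind (maxWeightStep 𝒮 h α))^[t] μ

/-- `π` is the law of a limiting steady-state queue vector under MaxWeight: the queue lengths,
started from some initial law, converge in distribution to `π`.  The initial law may be `π`
itself, so every stationary law of the chain is included. -/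
def IsMaxWeightSteadyState (𝒮 : Finset (Fin L → ℕ)) (h : 𝒮.Nonempty) (α : Fin L → PMF ℕ)
    (π : PMF (Fin L → ℕ)) : Prop :=
  ∃ μ : PMF (Fin L → ℕ),
    ∀ q, Tendsto (fun t => maxWeightLaw 𝒮 h α μ t q) atTop (𝓝 (π q))

/-- `π` is the law of a limiting steady-state queue vector under some feasible scheduling policy:
there are i.i.d. arrival vectors `A t`, feasible service vectors `S t`, chosen in any way
(depending on the history, randomized, even anticipating the arrivals), and queue lengths `Q t`
driven by them, which converge in distribution to `π`. -/
def IsFeasibleSteadyState (𝒮 : Finset (Fin L → ℕ)) (α : Fin L → PMF ℕ)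
    (π : PMF (Fin L → ℕ)) : Prop :=
  ∃ (Ω : Type) (_ : MeasurableSpace Ω) (P : Measure Ω) (_ : IsProbabilityMeasure P)
    (A S Q : ℕ → Ω → Fin L → ℕ),
    (∀ t, Measurable (A t)) ∧ (∀ t, Measurable (S t)) ∧ (∀ t, Measurable (Q t)) ∧
    iIndepFun A P ∧ (∀ t, P.map (A t) = (arrivalLaw α).toMeasure) ∧
    (∀ t ω, S t ω ∈ 𝒮) ∧
    (∀ t ω l, Q (t + 1) ω l = Q t ω l + A t ω l - S t ω l) ∧
    ∀ q, Tendsto (fun t => P (Q t ⁻¹' {q})) atTop (𝓝 (π q))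

/-- The expectation `E⟨c, Q⟩`, as an element of `[0, ∞]`, for `Q` with law `π` and `c ⪰ 0`. -/
def meanWorkload (c : EuclideanSpace ℝ (Fin L)) (π : PMF (Fin L → ℕ)) : ℝ≥0∞ :=
  ∫⁻ q, ENNReal.ofReal (inner ℝ c (toVec q)) ∂π.toMeasure

end MaxWeight

end

open MaxWeight

/-! Write x = ⟨c, Q⟩ for the workload across the face, ε for the gap, β = b - ⟨c, S⟩ ≥ 0 for the
service lost off the face, and υ ≥ 0 for the c-weighted unused service. One slot changes x by (⟨c,
A⟩ - b) + β + υ. Equating the stationary means of x² before and after a slot gives 2ε E x = ζ plus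
error terms, mainly E[xβ] and E[x'υ] with x' the next workload; everything rests on making them
vanish with ε.

The reason is state space collapse (`perp_second_moment_le`). The projection of the rate has a ball
of the hyperplane around it inside the face, of a radius uniform over C
(`IsMinimalDescription.exists_uniform_radius`). MaxWeight does at least as well as every point of
this ball, so the part of Q orthogonal to c has negative drift, and its second moment is bounded
uniformly in ε. Service off the face is chosen only when x is at most of the order of the orthogonal
part, and a queue with unused service ends the slot empty, which forces the orthogonal part to be of
order x. Young's inequality with weight κ = √ε bounds xβ and x'υ by κ‖perp‖² plus O(1/κ) times β and
υ. The linear terms are paid for by E(β + υ) = ε, which in the proof takes the form of a shifted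
square (x - M/2)² (`workload_drift`). The total error is O(√ε), so B is of order ε^(-1/2).

For the lower bound, no policy removes more than b of workload per slot, so x dominates pathwise a
Lindley recursion with increments ⟨c, A⟩ - b, to which Kingman's bound applies
(`le_of_eventually_lindley_le`). Its uniformly bounded second moments carry the bound to limits in
distribution (`eventually_integral_le`). Existence is Foster's criterion with the squared norm
(`exists_stationary`). -/

namespace MaxWeight

/-! ## Markov kernels on a discrete space -/

section Chain

variable {X : Type*} {κ : X → PMF X}

theorem tsum_bind_mul (π : PMF X) (κ : X → PMF X) (f : X → ℝ≥0∞) :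
    ∑' y, (π.bind κ) y * f y = ∑' x, π x * ∑' y, κ x y * f y := by
  simp_rw [PMF.bind_apply, ← ENNReal.tsum_mul_right, ← ENNReal.tsum_mul_left]
  rw [ENNReal.tsum_comm]
  simp_rw [mul_assoc]

theorem tsum_const_mul (π : PMF X) (C : ℝ≥0∞) : ∑' x, π x * C = C := by
  rw [ENNReal.tsum_mul_right, π.tsum_coe, one_mul]

theorem tsum_mul_mono (π : PMF X) {f g : X → ℝ≥0∞} (h : ∀ x, f x ≤ g x) :
    ∑' x, π x * f x ≤ ∑' x, π x * g x :=
  ENNReal.tsum_le_tsum fun x => mul_le_mul_right (h x) _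

theorem tsum_mul_add (π : PMF X) (f g : X → ℝ≥0∞) :
    ∑' x, π x * (f x + g x) = ∑' x, π x * f x + ∑' x, π x * g x := by
  simp_rw [mul_add]
  exact ENNReal.tsum_add

/-- A drift inequality bounds stationary means, without any a priori integrability. -/
theorem stationary_mean_le {π : PMF X} (hπ : π.bind κ = π) {V f g : X → ℝ≥0∞}
    (hV : ∀ x, V x ≠ ⊤) (h : ∀ x, ∑' y, κ x y * V y + f x ≤ V x + g x) :
    ∑' x, π x * f x ≤ ∑' x, π x * g x := by
  classical
  -- The truncation min(V, m) has finite mean, so it cancels by stationarity. Where V > m the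
  -- truncation cannot increase, so f is charged only on {V ≤ m}.
  have trunc : ∀ m : ℝ≥0, ∑' x, π x * (if V x ≤ m then f x else 0) ≤ ∑' x, π x * g x := by
    intro m
    have hm : ∀ x, ∑' y, κ x y * min (V y) m + (if V x ≤ m then f x else 0) ≤
        min (V x) m + g x := by
      intro x
      split_ifs with hx
      · rw [min_eq_left hx]
        exact le_trans (add_le_add_left (tsum_mul_mono _ fun y => min_le_left _ _) _) (h x)
      · rw [min_eq_right (le_of_not_ge hx), add_zero]
        refine le_trans ?_ le_self_add
        exact le_trans (tsum_mul_mono _ fun y => min_le_right _ _) (tsum_const_mul _ _).le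
    have hsum := tsum_mul_mono π hm
    rw [tsum_mul_add, tsum_mul_add, ← tsum_bind_mul π κ, hπ] at hsum
    refine (ENNReal.add_le_add_iff_left ?_).1 hsum
    refine ne_top_of_le_ne_top ENNReal.coe_ne_top (b := (m : ℝ≥0∞)) ?_
    exact le_trans (tsum_mul_mono _ fun y => min_le_right _ _) (tsum_const_mul _ _).le
  rw [ENNReal.tsum_eq_iSup_sum]
  refine iSup_le fun F => ?_
  -- A truncation level above V on all of F.
  set m : ℝ≥0 := ∑ x ∈ F, (V x).toNNReal with hm
  refine le_trans ?_ (trunc m)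
  refine le_trans (Finset.sum_le_sum fun x hx => ?_) (ENNReal.sum_le_tsum F)
  have : V x ≤ m := by
    rw [← ENNReal.coe_toNNReal (hV x), ENNReal.coe_le_coe]
    exact Finset.single_le_sum (f := fun x => (V x).toNNReal) (fun _ _ => zero_le) hx
  rw [if_pos this]

theorem pmf_eq_of_le {p q : PMF X} (h : ∀ x, p x ≤ q x) : p = q := by
  ext x
  refine le_antisymm (h x) (not_lt.1 fun hlt => ?_)
  have := ENNReal.tsum_lt_tsum (f := p) (g := q) (by simp [p.tsum_coe]) h hlt
  simp [p.tsum_coe, q.tsum_coe] at this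

/-- If `ν i` converges pointwise to `π` along a filter and applying the kernel changes `ν i` by
a vanishing amount, then `π` is stationary. -/
theorem bind_eq_of_tendsto {ι : Type*} {l : Filter ι} [l.NeBot] {ν : ι → X → ℝ≥0∞} {π : PMF X}
    {ν' : ι → X → ℝ≥0∞} (hν : ∀ x, Tendsto (fun i => ν i x) l (𝓝 (π x)))
    (hν' : ∀ x, Tendsto (fun i => ν' i x) l (𝓝 (π x)))
    (h : ∀ i y, ∑' x, ν i x * κ x y ≤ ν' i y) : π.bind κ = π := by
  -- An inequality suffices, both sides having mass one; it survives the limit on finite partial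
  -- sums, as in Fatou's lemma.
  refine pmf_eq_of_le fun y => ?_
  rw [PMF.bind_apply, ENNReal.tsum_eq_iSup_sum]
  refine iSup_le fun F => ?_
  refine le_of_tendsto_of_tendsto (tendsto_finsetSum F fun x _ =>
    ENNReal.Tendsto.mul_const (hν x) (Or.inr (PMF.apply_ne_top _ _))) (hν' y) ?_
  exact Eventually.of_forall fun i => (ENNReal.sum_le_tsum F).trans (h i y)

/-- The sequence shifted by one slot has the same limit. Hence every steady state, from any initial
law, is open to stationary drift arguments. -/
theorem bind_eq_of_tendsto_iterate {π μ : PMF X}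
    (h : ∀ x, Tendsto (fun t => (fun ν : PMF X => ν.bind κ)^[t] μ x) atTop (𝓝 (π x))) :
    π.bind κ = π := by
  refine bind_eq_of_tendsto h (fun x => (tendsto_add_atTop_iff_nat 1).2 (h x)) fun t y => ?_
  rw [Function.iterate_succ_apply', PMF.bind_apply]

/-- Foster's criterion: a drift condition towards finite sets gives a stationary law. -/
theorem exists_stationary {V f : X → ℝ≥0∞} {C : ℝ≥0} (x₀ : X) (hV : V x₀ ≠ ⊤)
    (hf : ∀ M : ℝ≥0, {x | f x ≤ M}.Finite)
    (h : ∀ x, ∑' y, κ x y * V y + f x ≤ V x + C) : ∃ π : PMF X, π.bind κ = π := by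
  classical
  set ν : ℕ → PMF X := fun t => (fun ν : PMF X => ν.bind κ)^[t] (PMF.pure x₀) with hνdef
  have hνs : ∀ t, ν (t + 1) = (ν t).bind κ := fun t => Function.iterate_succ_apply' _ _ _
  have hsum : ∀ n, ∑' x, ν n x * V x + ∑ t ∈ Finset.range n, ∑' x, ν t x * f x ≤
      V x₀ + n * C := by
    intro n
    induction n with
    | zero =>
      simp only [hνdef, Function.iterate_zero, id, Finset.range_zero, Finset.sum_empty, add_zero,
        Nat.cast_zero, zero_mul]
      rw [tsum_eq_single x₀ (fun x hx => by simp [hx])]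
      simp
    | succ n ih =>
      have h1 := tsum_mul_mono (ν n) h
      rw [tsum_mul_add, tsum_mul_add, ← tsum_bind_mul, ← hνs, tsum_const_mul] at h1
      calc _ = (∑' x, ν (n + 1) x * V x + ∑' x, ν n x * f x) +
            ∑ t ∈ Finset.range n, ∑' x, ν t x * f x := by
            rw [Finset.sum_range_succ]; ring
        _ ≤ (∑' x, ν n x * V x + C) + ∑ t ∈ Finset.range n, ∑' x, ν t x * f x := by gcongr
        _ = (∑' x, ν n x * V x + ∑ t ∈ Finset.range n, ∑' x, ν t x * f x) + C := by ring
        _ ≤ _ := by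
            refine (add_le_add_left ih _).trans (le_of_eq ?_)
            push_cast; ring
  -- Cesàro averages of the laws of the chain; `hsum` bounds their f-means uniformly.
  set a : ℕ → X → ℝ≥0∞ := fun n x => ((n : ℝ≥0∞) + 1)⁻¹ * ∑ t ∈ Finset.range (n + 1), ν t x
    with ha
  have hn0 : ∀ n : ℕ, (n : ℝ≥0∞) + 1 ≠ 0 := fun n => by simp
  have hnt : ∀ n : ℕ, (n : ℝ≥0∞) + 1 ≠ ⊤ := fun n => by simp
  have hasum : ∀ n, ∑' x, a n x = 1 := by
    intro n
    simp only [ha]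
    rw [ENNReal.tsum_mul_left, Summable.tsum_finsetSum fun _ _ => ENNReal.summable]
    simp only [PMF.tsum_coe, Finset.sum_const, Finset.card_range, nsmul_eq_mul, mul_one]
    push_cast
    exact ENNReal.inv_mul_cancel (hn0 n) (hnt n)
  have haf : ∀ n, ∑' x, a n x * f x ≤ V x₀ + C := by
    intro n
    simp only [ha, mul_assoc, Finset.sum_mul]
    rw [ENNReal.tsum_mul_left, Summable.tsum_finsetSum fun _ _ => ENNReal.summable]
    calc _ ≤ ((n : ℝ≥0∞) + 1)⁻¹ * (V x₀ + ((n + 1 : ℕ) : ℝ≥0∞) * C) :=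
          mul_le_mul_right (le_add_self.trans (hsum (n + 1))) _
      _ ≤ ((n : ℝ≥0∞) + 1)⁻¹ * (((n : ℝ≥0∞) + 1) * (V x₀ + C)) := by
          refine mul_le_mul_right ?_ _
          push_cast
          rw [mul_add]
          gcongr
          exact le_mul_of_one_le_left zero_le le_add_self
      _ = _ := by rw [← mul_assoc, ENNReal.inv_mul_cancel (hn0 n) (hnt n), one_mul]
  -- Along an ultrafilter the averages converge at all points at once, without extracting a diagonal
  -- subsequence.
  set u : Ultrafilter ℕ := hyperfilter ℕ
  have hlim : ∀ x, ∃ p, Tendsto (fun n => a n x) (u : Filter ℕ) (𝓝 p) := by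
    intro x
    obtain ⟨p, -, hp⟩ := isCompact_univ.ultrafilter_le_nhds (u.map fun n => a n x) (by simp)
    exact ⟨p, hp⟩
  choose p hp using hlim
  have hple : ∀ F : Finset X, ∑ x ∈ F, p x ≤ 1 := fun F =>
    le_of_tendsto (tendsto_finsetSum F fun x _ => hp x) <|
      Eventually.of_forall fun n => (ENNReal.sum_le_tsum F).trans (hasum n).le
  set D : ℝ≥0 := (V x₀).toNNReal + C with hD
  have hDV : (D : ℝ≥0∞) = V x₀ + C := by rw [hD, ENNReal.coe_add, ENNReal.coe_toNNReal hV]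
  -- Tightness: by Markov's inequality the averages put mass at most D / M outside the finite set {f
  -- ≤ M}, so no mass escapes in the limit.
  have hpge : ∀ M : ℝ≥0, 0 < M → 1 ≤ ∑' x, p x + (D / M : ℝ≥0) := by
    intro M hM
    set F := (hf M).toFinset with hF
    refine le_trans ?_ (add_le_add_left (ENNReal.sum_le_tsum F) _)
    refine ge_of_tendsto ((tendsto_finsetSum F fun x _ => hp x).add_const _)
      (Eventually.of_forall fun n => ?_)
    have hM0 : (M : ℝ≥0∞) ≠ 0 := by simpa using hM.ne'
    have hpt : ∀ x, a n x ≤ (if x ∈ F then a n x else 0) + (M : ℝ≥0∞)⁻¹ * (a n x * f x) := by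
      intro x
      split_ifs with hx
      · exact le_self_add
      · have : (M : ℝ≥0∞) ≤ f x := by
          simp only [hF, Set.Finite.mem_toFinset, Set.mem_ofPred_eq, not_le] at hx
          exact hx.le
        rw [zero_add]
        calc a n x = (M : ℝ≥0∞)⁻¹ * (a n x * M) := by
              rw [mul_comm (a n x), ← mul_assoc, ENNReal.inv_mul_cancel hM0 ENNReal.coe_ne_top,
                one_mul]
          _ ≤ _ := by gcongr
    calc (1 : ℝ≥0∞) = ∑' x, a n x := (hasum n).symm
      _ ≤ ∑' x, ((if x ∈ F then a n x else 0) + (M : ℝ≥0∞)⁻¹ * (a n x * f x)) :=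
          ENNReal.tsum_le_tsum hpt
      _ = ∑ x ∈ F, a n x + (M : ℝ≥0∞)⁻¹ * ∑' x, a n x * f x := by
          rw [ENNReal.tsum_add, ENNReal.tsum_mul_left]
          congr 1
          rw [tsum_eq_sum (s := F) (fun x hx => if_neg hx)]
          exact Finset.sum_congr rfl fun x hx => if_pos hx
      _ ≤ _ := by
          gcongr
          rw [ENNReal.coe_div hM.ne', ENNReal.div_eq_inv_mul, hDV]
          gcongr
          exact haf n
  have hp1 : ∑' x, p x = 1 := by
    refine le_antisymm ?_ (ENNReal.le_of_forall_pos_le_add fun e he _ => ?_)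
    · rw [ENNReal.tsum_eq_iSup_sum]
      exact iSup_le hple
    -- With this M, D / M ≤ e; the summand 1 keeps M positive when D = 0.
    · refine (hpge ((D + 1) / e) (by positivity)).trans ?_
      gcongr
      rw [div_div_eq_mul_div, div_le_iff₀ (by positivity), mul_comm]
      gcongr
      exact le_self_add
  refine ⟨⟨p, hp1 ▸ ENNReal.summable.hasSum⟩, ?_⟩
  refine bind_eq_of_tendsto (l := (u : Filter ℕ)) (ν := a)
    (ν' := fun n x => a n x + ((n : ℝ≥0∞) + 1)⁻¹) hp (fun x => ?_) fun n y => ?_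
  · have hz : Tendsto (fun n : ℕ => ((n : ℝ≥0∞) + 1)⁻¹) (u : Filter ℕ) (𝓝 0) := by
      have h1 : Tendsto (fun n : ℕ => ((n : ℝ≥0∞) + 1)⁻¹) atTop (𝓝 0) := by
        have := (tendsto_add_atTop_iff_nat 1).2 ENNReal.tendsto_inv_nat_nhds_zero
        exact_mod_cast this
      exact h1.mono_left (Nat.hyperfilter_le_atTop)
    have := (hp x).add hz
    rwa [add_zero] at this
  -- The kernel shifts the average by one slot, which adds at most one new term, of weight 1 / (n +
  -- 1).
  · simp only [ha, mul_assoc, Finset.sum_mul]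
    rw [ENNReal.tsum_mul_left, Summable.tsum_finsetSum fun _ _ => ENNReal.summable]
    nth_rewrite 3 [← mul_one ((n : ℝ≥0∞) + 1)⁻¹]
    rw [← mul_add]
    refine mul_le_mul_right ?_ _
    have : ∀ t, ∑' x, ν t x * κ x y = ν (t + 1) y := fun t => by rw [hνs, PMF.bind_apply]
    simp_rw [this]
    calc ∑ t ∈ Finset.range (n + 1), ν (t + 1) y
        ≤ ∑ t ∈ Finset.range (n + 2), ν t y := by
          rw [Finset.sum_range_succ' (fun t => ν t y)]
          exact le_self_add
      _ ≤ _ := by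
          rw [Finset.sum_range_succ _ (n + 1)]
          gcongr
          exact PMF.coe_le_one _ _

end Chain

end MaxWeight

namespace MaxWeight

variable {L K : ℕ}

/-! ## Moments of the arrivals -/

/-- The law of the arrival vector of one slot, as a measure. -/
noncomputable def arrivalMeasure (α : Fin L → PMF ℕ) : Measure (Fin L → ℕ) :=
  Measure.pi fun l => (α l).toMeasure

instance (α : Fin L → PMF ℕ) : IsProbabilityMeasure (arrivalMeasure α) := by
  unfold arrivalMeasure; infer_instance

theorem toMeasure_arrivalLaw (α : Fin L → PMF ℕ) :
    (arrivalLaw α).toMeasure = arrivalMeasure α :=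
  Measure.toPMF_toMeasure _

theorem tsum_mul_eq_lintegral {X : Type*} [Countable X] [MeasurableSpace X]
    [MeasurableSingletonClass X] (π : PMF X) (f : X → ℝ≥0∞) :
    ∑' x, π x * f x = ∫⁻ x, f x ∂π.toMeasure := by
  rw [lintegral_countable']
  exact tsum_congr fun x => by
    rw [PMF.toMeasure_apply_singleton _ _ (measurableSet_singleton x), mul_comm]

theorem ae_le_of_bounded {α : Fin L → PMF ℕ} {Amax : ℕ} (h : BoundedArrivals α Amax) :
    ∀ᵐ a ∂arrivalMeasure α, ∀ l, a l ≤ Amax := by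
  rw [ae_all_iff]
  intro l
  have h1 : ∀ᵐ n ∂(α l).toMeasure, n ≤ Amax := by
    rw [ae_iff, PMF.toMeasure_apply_eq_zero_iff _ (Set.to_countable _).measurableSet,
      Set.disjoint_left]
    intro n hn hn'
    exact hn' (h l n hn)
  exact (measurePreserving_eval (fun l => (α l).toMeasure) l).quasiMeasurePreserving.ae h1

/-- Bounded arrivals take almost surely only finitely many values, so integrability over one slot is
never an issue. -/
theorem integrable_arrival {α : Fin L → PMF ℕ} {Amax : ℕ} (h : BoundedArrivals α Amax)
    (f : (Fin L → ℕ) → ℝ) : Integrable f (arrivalMeasure α) := by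
  refine Integrable.of_bound (measurable_of_countable f).aestronglyMeasurable
    (∑ a ∈ Fintype.piFinset fun _ : Fin L => Finset.range (Amax + 1), ‖f a‖) ?_
  filter_upwards [ae_le_of_bounded h] with a ha
  refine Finset.single_le_sum (f := fun a => ‖f a‖) (fun _ _ => norm_nonneg _) ?_
  simpa [Fintype.mem_piFinset, Nat.lt_succ_iff] using ha

theorem inner_toVec (v : EuclideanSpace ℝ (Fin L)) (a : Fin L → ℕ) :
    inner ℝ v (toVec a) = ∑ l, v l * (a l : ℝ) := by
  simp [PiLp.inner_apply, toVec, mul_comm]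

theorem integral_inner {α : Fin L → PMF ℕ} {Amax : ℕ} (h : BoundedArrivals α Amax)
    (v : EuclideanSpace ℝ (Fin L)) :
    ∫ a, inner ℝ v (toVec a) ∂arrivalMeasure α = inner ℝ v (rate α) := by
  simp_rw [inner_toVec]
  rw [integral_finsetSum _ fun l _ => integrable_arrival h _]
  simp only [PiLp.inner_apply, rate]
  refine Finset.sum_congr rfl fun l _ => ?_
  rw [integral_const_mul]
  simp only [RCLike.inner_apply, conj_trivial]
  rw [mul_comm]
  congr 1
  exact integral_comp_eval (μ := fun l => (α l).toMeasure) (i := l) (f := fun n : ℕ => (n : ℝ))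
    (measurable_of_countable _).aestronglyMeasurable

theorem memLp_nat {p : PMF ℕ} {Amax : ℕ} (h : ∀ n ∈ p.support, n ≤ Amax) (r : ℝ) :
    MemLp (fun n : ℕ => r * (n : ℝ)) 2 p.toMeasure := by
  refine MemLp.of_bound (measurable_of_countable _).aestronglyMeasurable (|r| * Amax) ?_
  rw [ae_iff, PMF.toMeasure_apply_eq_zero_iff _ (Set.to_countable _).measurableSet,
    Set.disjoint_left]
  intro n hn hn'
  refine hn' ?_
  rw [norm_mul, Real.norm_eq_abs, Real.norm_natCast]
  have := h n hn
  gcongr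

/-- Independence over queues makes the variance of the weighted sum equal to ζ; the rest is the
squared bias about β. -/
theorem integral_sq {α : Fin L → PMF ℕ} {Amax : ℕ} (h : BoundedArrivals α Amax)
    (v : EuclideanSpace ℝ (Fin L)) (β : ℝ) :
    ∫ a, (inner ℝ v (toVec a) - β) ^ 2 ∂arrivalMeasure α =
      zeta v (arrivalVar α) + (inner ℝ v (rate α) - β) ^ 2 := by
  have hvar : variance (fun a : Fin L → ℕ => inner ℝ v (toVec a)) (arrivalMeasure α) =
      zeta v (arrivalVar α) := by
    have := variance_sum_pi (μ := fun l => (α l).toMeasure)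
      (X := fun l => fun n : ℕ => v l * (n : ℝ)) fun l => memLp_nat (h l) (v l)
    have he : (fun a : Fin L → ℕ => (inner ℝ v (toVec a) : ℝ)) =
        ∑ l, fun a : Fin L → ℕ => v l * (a l : ℝ) := by
      ext a
      rw [inner_toVec, Finset.sum_apply]
    rw [he]
    refine this.trans (Finset.sum_congr rfl fun l _ => ?_)
    rw [variance_const_mul]
    rfl
  have hm : MemLp (fun a : Fin L → ℕ => (inner ℝ v (toVec a) : ℝ)) 2 (arrivalMeasure α) :=
    (memLp_two_iff_integrable_sq (measurable_of_countable _).aestronglyMeasurable).2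
      (integrable_arrival h _)
  rw [variance_eq_sub hm, integral_inner h] at hvar
  have he : ∀ a : Fin L → ℕ, ((inner ℝ v (toVec a) : ℝ) - β) ^ 2 =
      ((fun a => (inner ℝ v (toVec a) : ℝ)) ^ 2) a - 2 * β * inner ℝ v (toVec a) + β ^ 2 := by
    intro a; simp only [Pi.pow_apply]; ring
  simp_rw [he]
  rw [integral_add (f := fun a : Fin L → ℕ => ((fun a => (inner ℝ v (toVec a) : ℝ)) ^ 2) a -
      2 * β * inner ℝ v (toVec a)) (integrable_arrival h _) (integrable_const _),
    integral_sub (integrable_arrival h _) (integrable_arrival h _), integral_const_mul,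
    integral_inner h, ← hvar]
  simp only [integral_const, probReal_univ, one_smul]
  ring

/-! ## One slot of MaxWeight -/

section Step

variable {𝒮 : Finset (Fin L → ℕ)} {h𝒮 : 𝒮.Nonempty} {α : Fin L → PMF ℕ} {Amax : ℕ}

theorem tsum_maxWeightStep (q : Fin L → ℕ) (F : (Fin L → ℕ) → ℝ≥0∞) :
    ∑' y, maxWeightStep 𝒮 h𝒮 α q y * F y =
      ∑' s, PMF.uniformOfFinset (maxWeightSchedules 𝒮 q) (maxWeightSchedules_nonempty h𝒮 q) s *
        ∫⁻ a, F (q + a - s) ∂arrivalMeasure α := by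
  rw [maxWeightStep, tsum_bind_mul]
  refine tsum_congr fun s => ?_
  congr 1
  rw [← PMF.bind_pure_comp, tsum_bind_mul, ← toMeasure_arrivalLaw, ← tsum_mul_eq_lintegral]
  refine tsum_congr fun a => ?_
  congr 1
  rw [tsum_eq_single (q + a - s) fun y hy => by simp [hy]]
  simp

theorem tsum_maxWeightStep_le (hα : BoundedArrivals α Amax) {q : Fin L → ℕ}
    {V : (Fin L → ℕ) → ℝ} (hV : ∀ q, 0 ≤ V q) {y : ℝ}
    (h : ∀ s ∈ maxWeightSchedules 𝒮 q, ∫ a, V (q + a - s) ∂arrivalMeasure α ≤ y) :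
    ∑' y, maxWeightStep 𝒮 h𝒮 α q y * ENNReal.ofReal (V y) ≤ ENNReal.ofReal y := by
  rw [tsum_maxWeightStep, ← tsum_const_mul (PMF.uniformOfFinset (maxWeightSchedules 𝒮 q)
    (maxWeightSchedules_nonempty h𝒮 q)) (ENNReal.ofReal y)]
  refine ENNReal.tsum_le_tsum fun s => ?_
  by_cases hs : s ∈ maxWeightSchedules 𝒮 q
  · rw [← ofReal_integral_eq_lintegral_ofReal (integrable_arrival hα _)
      (Eventually.of_forall fun a => hV _)]
    gcongr
    exact h s hs
  · simp [hs]

theorem le_tsum_maxWeightStep (hα : BoundedArrivals α Amax) {q : Fin L → ℕ}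
    {V : (Fin L → ℕ) → ℝ} (hV : ∀ q, 0 ≤ V q) {y : ℝ}
    (h : ∀ s ∈ maxWeightSchedules 𝒮 q, y ≤ ∫ a, V (q + a - s) ∂arrivalMeasure α) :
    ENNReal.ofReal y ≤ ∑' y, maxWeightStep 𝒮 h𝒮 α q y * ENNReal.ofReal (V y) := by
  rw [tsum_maxWeightStep, ← tsum_const_mul (PMF.uniformOfFinset (maxWeightSchedules 𝒮 q)
    (maxWeightSchedules_nonempty h𝒮 q)) (ENNReal.ofReal y)]
  refine ENNReal.tsum_le_tsum fun s => ?_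
  by_cases hs : s ∈ maxWeightSchedules 𝒮 q
  · rw [← ofReal_integral_eq_lintegral_ofReal (integrable_arrival hα _)
      (Eventually.of_forall fun a => hV _)]
    gcongr
    exact h s hs
  · simp [hs]

theorem maxWeight_drift (hα : BoundedArrivals α Amax) {q : Fin L → ℕ}
    {V f g : (Fin L → ℕ) → ℝ} (hV : ∀ q, 0 ≤ V q) (hf : ∀ q, 0 ≤ f q) (hg : ∀ q, 0 ≤ g q)
    (h : ∀ s ∈ maxWeightSchedules 𝒮 q,
      ∫ a, V (q + a - s) ∂arrivalMeasure α ≤ V q + g q - f q) :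
    ∑' y, maxWeightStep 𝒮 h𝒮 α q y * ENNReal.ofReal (V y) + ENNReal.ofReal (f q) ≤
      ENNReal.ofReal (V q) + ENNReal.ofReal (g q) := by
  obtain ⟨s, hs⟩ := maxWeightSchedules_nonempty h𝒮 q
  -- Needed because `ENNReal.ofReal` sends negative numbers to 0.
  have h0 : 0 ≤ V q + g q - f q := le_trans (integral_nonneg fun a => hV _) (h s hs)
  refine (add_le_add_left (tsum_maxWeightStep_le hα hV h) _).trans (le_of_eq ?_)
  rw [← ENNReal.ofReal_add h0 (hf q), ← ENNReal.ofReal_add (hV q) (hg q)]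
  congr 1
  ring

/-- Stationary means under MaxWeight, from a drift inequality for each maximizing schedule. -/
theorem maxWeight_mean_le (hα : BoundedArrivals α Amax) {π : PMF (Fin L → ℕ)}
    (hπ : π.bind (maxWeightStep 𝒮 h𝒮 α) = π)
    {V f g : (Fin L → ℕ) → ℝ} (hV : ∀ q, 0 ≤ V q) (hf : ∀ q, 0 ≤ f q) (hg : ∀ q, 0 ≤ g q)
    (h : ∀ q, ∀ s ∈ maxWeightSchedules 𝒮 q,
      ∫ a, V (q + a - s) ∂arrivalMeasure α ≤ V q + g q - f q) :
    ∑' q, π q * ENNReal.ofReal (f q) ≤ ∑' q, π q * ENNReal.ofReal (g q) :=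
  stationary_mean_le hπ (fun _ => ENNReal.ofReal_ne_top) fun q =>
    maxWeight_drift hα hV hf hg (h q)

theorem IsMaxWeightSteadyState.bind_eq {π : PMF (Fin L → ℕ)}
    (h : IsMaxWeightSteadyState 𝒮 h𝒮 α π) : π.bind (maxWeightStep 𝒮 h𝒮 α) = π :=
  let ⟨_, hμ⟩ := h
  bind_eq_of_tendsto_iterate hμ

theorem isMaxWeightSteadyState_of_bind_eq {π : PMF (Fin L → ℕ)}
    (h : π.bind (maxWeightStep 𝒮 h𝒮 α) = π) : IsMaxWeightSteadyState 𝒮 h𝒮 α π := by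
  refine ⟨π, fun q => ?_⟩
  have : ∀ t, maxWeightLaw 𝒮 h𝒮 α π t = π := fun t => Function.iterate_fixed h t
  simp_rw [this]
  exact tendsto_const_nhds

end Step

end MaxWeight

namespace MaxWeight

variable {L K : ℕ}

/-! ## Geometry of the capacity region -/

section Geometry

variable {𝒮 : Finset (Fin L → ℕ)} {c : Fin K → EuclideanSpace ℝ (Fin L)} {b : Fin K → ℝ}

theorem toVec_mem_capacityRegion {s : Fin L → ℕ} (hs : s ∈ 𝒮) : toVec s ∈ capacityRegion 𝒮 :=
  subset_convexHull ℝ _ (Set.mem_image_of_mem _ (Finset.mem_coe.2 hs))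

theorem IsMinimalDescription.inner_le (hd : IsMinimalDescription 𝒮 c b) (k : Fin K)
    {r : EuclideanSpace ℝ (Fin L)} (hr : r ∈ capacityRegion 𝒮) : inner ℝ (c k) r ≤ b k := by
  rw [hd.region_eq] at hr
  exact hr.2 k (Set.mem_univ k)

theorem IsMinimalDescription.inner_self (hd : IsMinimalDescription 𝒮 c b) (k : Fin K) :
    inner ℝ (c k) (c k) = (1 : ℝ) := by
  rw [real_inner_self_eq_norm_sq, hd.norm_eq_one, one_pow]

/-- A linear functional maximized over 𝒮 is maximized over the convex hull. This is the only
property of MaxWeight that the drift estimates use. -/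
theorem inner_le_of_mem_maxWeightSchedules {q s : Fin L → ℕ}
    (hs : s ∈ maxWeightSchedules 𝒮 q) {r : EuclideanSpace ℝ (Fin L)}
    (hr : r ∈ capacityRegion 𝒮) :
    (inner ℝ (toVec q) r : ℝ) ≤ inner ℝ (toVec q) (toVec s) := by
  have hconv : Convex ℝ {r : EuclideanSpace ℝ (Fin L) |
      (inner ℝ (toVec q) r : ℝ) ≤ inner ℝ (toVec q) (toVec s)} :=
    convex_halfSpace_le (f := fun r : EuclideanSpace ℝ (Fin L) => (inner ℝ (toVec q) r : ℝ))
      ⟨fun x y => inner_add_right _ _ _, fun a x => inner_smul_right _ _ _⟩ _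
  refine convexHull_min ?_ hconv hr
  rintro _ ⟨s', hs', rfl⟩
  have := (Finset.mem_filter.1 hs).2 s' hs'
  simp only [Set.mem_ofPred_eq, inner_toVec]
  simp only [toVec]
  exact_mod_cast this

theorem IsMinimalDescription.inner_lt_of_mem_interior (hd : IsMinimalDescription 𝒮 c b)
    (k : Fin K) {r : EuclideanSpace ℝ (Fin L)} (hr : r ∈ interior (capacityRegion 𝒮)) :
    inner ℝ (c k) r < b k := by
  obtain ⟨δ, hδ, hball⟩ := Metric.isOpen_iff.1 isOpen_interior r hr
  have hmem : r + (δ / 2) • c k ∈ capacityRegion 𝒮 := by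
    refine interior_subset (hball ?_)
    rw [Metric.mem_ball, dist_eq_norm, add_sub_cancel_left, norm_smul, hd.norm_eq_one,
      Real.norm_of_nonneg (by positivity)]
    linarith
  have := hd.inner_le k hmem
  rw [inner_add_right, inner_smul_right, hd.inner_self] at this
  linarith

theorem infDist_hyperplane {c r : EuclideanSpace ℝ (Fin L)} {b : ℝ} (hc : ‖c‖ = 1)
    (hr : inner ℝ c r ≤ b) : Metric.infDist r (hyperplane c b) = b - inner ℝ c r := by
  have hcc : (inner ℝ c c : ℝ) = 1 := by rw [real_inner_self_eq_norm_sq, hc, one_pow]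
  have hmem : r + (b - inner ℝ c r) • c ∈ hyperplane c b := by
    simp only [hyperplane, Set.mem_ofPred_eq, inner_add_right, inner_smul_right, hcc]
    ring
  refine le_antisymm ?_ ?_
  · refine (Metric.infDist_le_dist_of_mem hmem).trans (le_of_eq ?_)
    rw [dist_eq_norm, sub_add_cancel_left, norm_neg, norm_smul, hc, mul_one,
      Real.norm_of_nonneg (by linarith)]
  · refine (Metric.le_infDist ⟨_, hmem⟩).2 fun y hy => ?_
    have hy' : inner ℝ c y = b := hy
    have := real_inner_le_norm c (y - r)
    rw [inner_sub_right, hy', hc, one_mul] at this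
    rwa [dist_comm, dist_eq_norm]

theorem IsMinimalDescription.gap_eq (hd : IsMinimalDescription 𝒮 c b) (k : Fin K)
    {α : Fin L → PMF ℕ} (hα : rate α ∈ interior (capacityRegion 𝒮)) :
    gap α (c k) (b k) = b k - inner ℝ (c k) (rate α) :=
  infDist_hyperplane (hd.norm_eq_one k) (hd.inner_lt_of_mem_interior k hα).le

theorem IsMinimalDescription.gap_pos (hd : IsMinimalDescription 𝒮 c b) (k : Fin K)
    {α : Fin L → PMF ℕ} (hα : rate α ∈ interior (capacityRegion 𝒮)) :
    0 < gap α (c k) (b k) := by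
  rw [hd.gap_eq k hα]
  linarith [hd.inner_lt_of_mem_interior k hα]

/-- By minimality, a face contains a point that satisfies every other constraint strictly. -/
theorem IsMinimalDescription.exists_strict (hd : IsMinimalDescription 𝒮 c b) (k : Fin K) :
    ∃ z : EuclideanSpace ℝ (Fin L), inner ℝ (c k) z = b k ∧ (∀ l, 0 < z l) ∧
      ∀ j, j ≠ k → inner ℝ (c j) z < b j := by
  have hne := hd.minimal k
  obtain ⟨r, hr, hrk⟩ : ∃ r, r ∈ polyhedron c b {k}ᶜ ∧ b k < inner ℝ (c k) r := by
    by_contra! hcon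
    refine hne (Set.Subset.antisymm (fun r hr => ?_) ?_)
    · rw [hd.region_eq]
      refine ⟨hr.1, fun j _ => ?_⟩
      by_cases hj : j = k
      · subst hj
        exact hcon r hr
      · exact hr.2 j hj
    · rw [hd.region_eq]
      exact fun r hr => ⟨hr.1, fun j _ => hr.2 j (Set.mem_univ j)⟩
  -- A small multiple of the all-ones vector satisfies every constraint strictly, as all offsets are
  -- positive. The segment from it to r, which violates only constraint k, crosses the hyperplane at
  -- parameter θ < 1, where the other constraints are still strict.
  set o : EuclideanSpace ℝ (Fin L) := WithLp.toLp 2 fun _ => (1 : ℝ) with ho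
  have hev : ∀ᶠ t : ℝ in 𝓝[>] 0, ∀ j, t * inner ℝ (c j) o < b j := by
    rw [eventually_all]
    intro j
    have hc : Tendsto (fun t : ℝ => t * inner ℝ (c j) o) (𝓝[>] 0) (𝓝 (0 * inner ℝ (c j) o)) :=
      (tendsto_id.mono_left nhdsWithin_le_nhds).mul_const _
    rw [zero_mul] at hc
    exact hc.eventually_lt_const (hd.offset_pos j)
  obtain ⟨t, ht, ht0⟩ := (hev.and self_mem_nhdsWithin).exists
  have ht0 : 0 < t := ht0
  set p := t * inner ℝ (c k) o with hp
  set x : ℝ := inner ℝ (c k) r with hx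
  have hpb : p < b k := ht k
  set θ := (b k - p) / (x - p) with hθ
  have hxp : 0 < x - p := by linarith
  have hθ0 : 0 < θ := div_pos (by linarith) hxp
  have hθ1 : θ < 1 := (div_lt_one hxp).2 (by linarith)
  have hin : ∀ j, inner ℝ (c j) ((1 - θ) • t • o + θ • r) =
      (1 - θ) * (t * inner ℝ (c j) o) + θ * inner ℝ (c j) r := fun j => by
    rw [inner_add_right, inner_smul_right, inner_smul_right, inner_smul_right]
  refine ⟨(1 - θ) • t • o + θ • r, ?_, fun l => ?_, fun j hj => ?_⟩
  · rw [hin, ← hp, ← hx]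
    have : θ * (x - p) = b k - p := div_mul_cancel₀ _ hxp.ne'
    linarith
  · simp only [ho, PiLp.add_apply, PiLp.smul_apply, smul_eq_mul, mul_one]
    have := hr.1 l
    have : 0 < 1 - θ := by linarith
    positivity
  · rw [hin]
    have h1 := ht j
    have h2 : inner ℝ (c j) r ≤ b j := hr.2 j hj
    nlinarith

/-- The projection to a hyperplane along its normal. -/
noncomputable def hyperplaneProj (c : EuclideanSpace ℝ (Fin L)) (b : ℝ)
    (x : EuclideanSpace ℝ (Fin L)) : EuclideanSpace ℝ (Fin L) :=
  x + (b - inner ℝ c x) • c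

theorem continuous_hyperplaneProj (c : EuclideanSpace ℝ (Fin L)) (b : ℝ) :
    Continuous (hyperplaneProj c b) := by
  unfold hyperplaneProj
  fun_prop

theorem hyperplaneProj_of_mem {c x : EuclideanSpace ℝ (Fin L)} {b : ℝ} (h : inner ℝ c x = b) :
    hyperplaneProj c b x = x := by
  simp [hyperplaneProj, h]

theorem inner_hyperplaneProj {c : EuclideanSpace ℝ (Fin L)} (hc : inner ℝ c c = (1 : ℝ)) (b : ℝ)
    (x : EuclideanSpace ℝ (Fin L)) : inner ℝ c (hyperplaneProj c b x) = b := by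
  simp only [hyperplaneProj, inner_add_right, inner_smul_right, hc]
  ring

/-- A short step from the strict point z towards x stays in the face, and the line through both
reaches x. So the face spans its hyperplane, and relative interior means interior within the
hyperplane. -/
theorem IsMinimalDescription.hyperplane_subset_affineSpan (hd : IsMinimalDescription 𝒮 c b)
    (k : Fin K) {x : EuclideanSpace ℝ (Fin L)} (hx : inner ℝ (c k) x = b k) :
    x ∈ affineSpan ℝ (face 𝒮 (c k) (b k)) := by
  obtain ⟨z, hzk, hz0, hzj⟩ := hd.exists_strict k
  have hcont : ContinuousAt (fun t : ℝ => z + t • (x - z)) 0 := by fun_prop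
  have hev1 : ∀ᶠ t : ℝ in 𝓝 0, ∀ l, 0 < (z + t • (x - z)) l := by
    rw [eventually_all]
    intro l
    have hc : ContinuousAt (fun t : ℝ => (z + t • (x - z)) l) 0 := by fun_prop
    exact hc.eventually_const_lt (by simpa using hz0 l)
  have hev2 : ∀ᶠ t : ℝ in 𝓝 0, ∀ j, j ≠ k → inner ℝ (c j) (z + t • (x - z)) < b j := by
    rw [eventually_all]
    intro j
    by_cases hj : j = k
    · simp [hj]
    · have hc : ContinuousAt (fun t : ℝ => (inner ℝ (c j) (z + t • (x - z)) : ℝ)) 0 := by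
        fun_prop
      have hlt : (inner ℝ (c j) (z + (0 : ℝ) • (x - z)) : ℝ) < b j := by simpa using hzj j hj
      filter_upwards [Tendsto.eventually_lt_const hlt hc] with t ht _ using ht
  have hin : ∀ t : ℝ, inner ℝ (c k) (z + t • (x - z)) = b k := fun t => by
    rw [inner_add_right, inner_smul_right, inner_sub_right, hx, hzk]; ring
  have hmem : ∀ t : ℝ, (∀ l, 0 < (z + t • (x - z)) l) →
      (∀ j, j ≠ k → inner ℝ (c j) (z + t • (x - z)) < b j) →
      z + t • (x - z) ∈ face 𝒮 (c k) (b k) := by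
    intro t h1 h2
    refine ⟨hin t, ?_⟩
    rw [hd.region_eq]
    refine ⟨fun l => (h1 l).le, fun j _ => ?_⟩
    by_cases hj : j = k
    · rw [hj]
      exact (hin t).le
    · exact (h2 j hj).le
  obtain ⟨t, ⟨h1, h2⟩, ht⟩ := (((hev1.and hev2).filter_mono
    (nhdsWithin_le_nhds (s := Set.Ioi 0))).and self_mem_nhdsWithin).exists
  have ht : 0 < t := ht
  have hy := subset_affineSpan ℝ _ (hmem t h1 h2)
  have hz := subset_affineSpan ℝ _ (hmem 0 (by simpa using hz0) (by simpa using hzj))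
  rw [zero_smul, add_zero] at hz
  have := AffineMap.lineMap_mem (t⁻¹) hz hy
  rwa [AffineMap.lineMap_apply, vsub_eq_sub, add_sub_cancel_left, smul_smul,
    inv_mul_cancel₀ ht.ne', one_smul, vadd_eq_add, sub_add_cancel] at this

/-- Points of a compact subset of the relative interior of a face can be moved within the
hyperplane by a uniform amount. -/
theorem IsMinimalDescription.exists_uniform_radius (hd : IsMinimalDescription 𝒮 c b) (k : Fin K)
    {C : Set (EuclideanSpace ℝ (Fin L))} (hC : IsCompact C)
    (hCF : C ⊆ intrinsicInterior ℝ (face 𝒮 (c k) (b k))) :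
    ∃ δ > 0, ∀ r ∈ C, ∀ v : EuclideanSpace ℝ (Fin L), inner ℝ (c k) v = (0 : ℝ) → ‖v‖ < δ →
      r + v ∈ face 𝒮 (c k) (b k) := by
  set F := face 𝒮 (c k) (b k)
  -- Pulling the face back along the projection to the hyperplane turns its relative interior into
  -- an open set of the whole space, to which compactness of C applies.
  have hsub : C ⊆ interior (hyperplaneProj (c k) (b k) ⁻¹' F) := by
    intro r hr
    obtain ⟨y, hy, rfl⟩ := mem_intrinsicInterior.1 (hCF hr)
    set g : EuclideanSpace ℝ (Fin L) → affineSpan ℝ F := fun x =>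
      ⟨hyperplaneProj (c k) (b k) x, hd.hyperplane_subset_affineSpan k
        (inner_hyperplaneProj (hd.inner_self k) _ _)⟩ with hg
    have hgc : Continuous g := (continuous_hyperplaneProj _ _).subtype_mk _
    have hyF : (y : EuclideanSpace ℝ (Fin L)) ∈ F :=
      (interior_subset hy : y ∈ (↑) ⁻¹' F)
    refine mem_interior.2 ⟨g ⁻¹' interior ((↑) ⁻¹' F), ?_, isOpen_interior.preimage hgc, ?_⟩
    · intro x hx
      exact (interior_subset (Set.mem_preimage.1 hx) : g x ∈ (↑) ⁻¹' F)
    · have : g y = y := Subtype.ext (hyperplaneProj_of_mem hyF.1)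
      rwa [Set.mem_preimage, this]
  obtain ⟨δ, hδ, hth⟩ := hC.exists_thickening_subset_open isOpen_interior hsub
  refine ⟨δ, hδ, fun r hr v hv hvδ => ?_⟩
  have hmem := interior_subset (hth (Metric.mem_thickening_iff.2 ⟨r, hr, by
    rw [dist_eq_norm, add_sub_cancel_left]; exact hvδ⟩ : r + v ∈ Metric.thickening δ C))
  have hrb : inner ℝ (c k) r = b k := (intrinsicInterior_subset (hCF hr)).1
  rwa [Set.mem_preimage, hyperplaneProj_of_mem] at hmem
  rw [inner_add_right, hv, hrb, add_zero]

end Geometry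

end MaxWeight

namespace MaxWeight

variable {L K : ℕ}

/-! ## The queue recursion in Euclidean space -/

theorem toVec_nonneg (q : Fin L → ℕ) (l : Fin L) : 0 ≤ toVec q l := by
  simp [toVec]

theorem norm_le_norm_of_abs_le {x y : EuclideanSpace ℝ (Fin L)} (h : ∀ l, |x l| ≤ |y l|) :
    ‖x‖ ≤ ‖y‖ := by
  rw [EuclideanSpace.norm_eq, EuclideanSpace.norm_eq]
  refine Real.sqrt_le_sqrt (Finset.sum_le_sum fun l _ => ?_)
  rw [Real.norm_eq_abs, Real.norm_eq_abs]
  exact pow_le_pow_left₀ (abs_nonneg _) (h l) 2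

theorem norm_toVec_mono {a a' : Fin L → ℕ} (h : ∀ l, a l ≤ a' l) : ‖toVec a‖ ≤ ‖toVec a'‖ := by
  refine norm_le_norm_of_abs_le fun l => ?_
  rw [abs_of_nonneg (toVec_nonneg _ _), abs_of_nonneg (toVec_nonneg _ _)]
  simpa [toVec] using h l

/-- The recursion, with the unused service `(s - (q + a))⁺`. -/
theorem toVec_next (q a s : Fin L → ℕ) :
    toVec (q + a - s) = toVec q + toVec a - toVec s + toVec (s - (q + a)) := by
  ext l
  simp only [toVec, PiLp.add_apply, PiLp.sub_apply, Pi.sub_apply, Pi.add_apply]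
  rcases le_total (s l) (q l + a l) with h | h
  · rw [Nat.cast_sub h, Nat.sub_eq_zero_of_le h]
    push_cast; ring
  · rw [Nat.cast_sub h, Nat.sub_eq_zero_of_le h]
    push_cast; ring

/-- Clipping negative coordinates to zero shrinks the norm. -/
theorem norm_toVec_next_le (q a s : Fin L → ℕ) :
    ‖toVec (q + a - s)‖ ≤ ‖toVec q + toVec a - toVec s‖ := by
  refine norm_le_norm_of_abs_le fun l => ?_
  simp only [toVec, PiLp.add_apply, PiLp.sub_apply, Pi.sub_apply, Pi.add_apply]
  rcases le_total (s l) (q l + a l) with h | h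
  · rw [Nat.cast_sub h]
    push_cast; exact le_rfl
  · rw [Nat.sub_eq_zero_of_le h]
    simp

theorem norm_toVec_unused_le (q a s : Fin L → ℕ) : ‖toVec (s - (q + a))‖ ≤ ‖toVec s‖ :=
  norm_toVec_mono fun l => by simp

theorem inner_toVec_nonneg {c : EuclideanSpace ℝ (Fin L)} (hc : ∀ l, 0 ≤ c l)
    (q : Fin L → ℕ) : 0 ≤ (inner ℝ c (toVec q) : ℝ) := by
  rw [inner_toVec]
  exact Finset.sum_nonneg fun l _ => mul_nonneg (hc l) (Nat.cast_nonneg _)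

/-- The component of `x` orthogonal to `c`, for `c` a unit vector (or zero). -/
noncomputable def perp (c x : EuclideanSpace ℝ (Fin L)) : EuclideanSpace ℝ (Fin L) :=
  x - (inner ℝ c x : ℝ) • c

section Perp

variable {c : EuclideanSpace ℝ (Fin L)}

/-- The hypothesis `hc` covers exactly unit vectors and c = 0. In the latter case `perp` is the
identity, so the collapse estimates also serve for the whole queue vector. -/
theorem inner_self_mul_inner (hc : (inner ℝ c c : ℝ) • c = c) (x : EuclideanSpace ℝ (Fin L)) :
    (inner ℝ c c : ℝ) * inner ℝ c x = inner ℝ c x := by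
  conv_rhs => rw [← hc]
  rw [real_inner_smul_left]

theorem inner_perp (hc : (inner ℝ c c : ℝ) • c = c) (x : EuclideanSpace ℝ (Fin L)) :
    (inner ℝ c (perp c x) : ℝ) = 0 := by
  rw [perp, inner_sub_right, inner_smul_right]
  linarith [inner_self_mul_inner hc x]

theorem inner_perp_left (x y : EuclideanSpace ℝ (Fin L)) :
    (inner ℝ (perp c x) y : ℝ) = inner ℝ x y - inner ℝ c x * inner ℝ c y := by
  rw [perp, inner_sub_left, real_inner_smul_left]

theorem inner_self_perp (x : EuclideanSpace ℝ (Fin L)) :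
    (inner ℝ x (perp c x) : ℝ) = ‖x‖ ^ 2 - (inner ℝ c x) ^ 2 := by
  rw [real_inner_comm, inner_perp_left, real_inner_self_eq_norm_sq, sq (inner ℝ c x : ℝ)]

theorem norm_perp_sq (hc : (inner ℝ c c : ℝ) • c = c) (x : EuclideanSpace ℝ (Fin L)) :
    ‖perp c x‖ ^ 2 = ‖x‖ ^ 2 - (inner ℝ c x) ^ 2 := by
  rw [← real_inner_self_eq_norm_sq, inner_perp_left, inner_perp hc, mul_zero, sub_zero,
    inner_self_perp]

theorem norm_perp_le (hc : (inner ℝ c c : ℝ) • c = c) (x : EuclideanSpace ℝ (Fin L)) :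
    ‖perp c x‖ ≤ ‖x‖ := by
  refine (sq_le_sq₀ (norm_nonneg _) (norm_nonneg _)).1 ?_
  rw [norm_perp_sq hc]
  linarith [sq_nonneg (inner ℝ c x : ℝ)]

theorem perp_sub (x y : EuclideanSpace ℝ (Fin L)) : perp c (x - y) = perp c x - perp c y := by
  simp only [perp, inner_sub_right, sub_smul]
  abel

end Perp

/-! ## Uniform second moments -/

section Moments

variable {𝒮 : Finset (Fin L → ℕ)} {h𝒮 : 𝒮.Nonempty} {α : Fin L → PMF ℕ} {Amax : ℕ}
  {c : EuclideanSpace ℝ (Fin L)} {D d : ℝ}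

/-- `D` bounds the norms of the feasible services and of the arrivals. -/
def IsSizeBound (𝒮 : Finset (Fin L → ℕ)) (Amax : ℕ) (D : ℝ) : Prop :=
  (∀ s ∈ 𝒮, ‖toVec s‖ ≤ D) ∧ ∀ a : Fin L → ℕ, (∀ l, a l ≤ Amax) → ‖toVec a‖ ≤ D

theorem exists_isSizeBound (𝒮 : Finset (Fin L → ℕ)) (Amax : ℕ) :
    ∃ D, 0 ≤ D ∧ IsSizeBound 𝒮 Amax D := by
  refine ⟨∑ s ∈ 𝒮, ‖toVec s‖ + ‖toVec (fun _ : Fin L => Amax)‖,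
    add_nonneg (Finset.sum_nonneg fun _ _ => norm_nonneg _) (norm_nonneg _),
    fun s hs => ?_, fun a ha => ?_⟩
  · have := Finset.single_le_sum (f := fun s => ‖toVec s‖) (fun _ _ => norm_nonneg _) hs
    exact this.trans (le_add_of_nonneg_right (norm_nonneg _))
  · exact (norm_toVec_mono ha).trans
      (le_add_of_nonneg_left (Finset.sum_nonneg fun _ _ => norm_nonneg _))

theorem norm_toVec_next_sub_le (hD : IsSizeBound 𝒮 Amax D) {q a s : Fin L → ℕ} (hs : s ∈ 𝒮)
    (ha : ∀ l, a l ≤ Amax) : ‖toVec (q + a - s) - toVec q‖ ≤ 3 * D := by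
  have he : toVec (q + a - s) - toVec q = toVec a - toVec s + toVec (s - (q + a)) := by
    rw [toVec_next]; abel
  rw [he]
  have h1 := norm_add_le (toVec a - toVec s) (toVec (s - (q + a)))
  have h2 := norm_sub_le (toVec a) (toVec s)
  linarith [hD.1 s hs, hD.2 a ha, norm_toVec_unused_le q a s]

/-- Negative drift of `w²` and bounded increments bound the second moment of `w`. -/
theorem second_moment_le (hα : BoundedArrivals α Amax) {π : PMF (Fin L → ℕ)}
    (hπ : π.bind (maxWeightStep 𝒮 h𝒮 α) = π) {w : (Fin L → ℕ) → ℝ} (hw : ∀ q, 0 ≤ w q)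
    {C : ℝ} (hD : 0 ≤ D) (hd : 0 < d)
    (hinc : ∀ q, ∀ s ∈ 𝒮, ∀ a : Fin L → ℕ, (∀ l, a l ≤ Amax) → |w (q + a - s) - w q| ≤ D)
    (hdrift : ∀ q, ∀ s ∈ maxWeightSchedules 𝒮 q,
      ∫ a, w (q + a - s) ^ 2 ∂arrivalMeasure α ≤ w q ^ 2 + C - 2 * d * w q) :
    ∑' q, π q * ENNReal.ofReal (w q ^ 2) ≤
      ENNReal.ofReal ((D ^ 3 + 9 / 32 * (C + D ^ 2) ^ 2 / d) / d) := by
  -- A cubic test function turns the drift -2dw of w² into -3w². One w² is kept as the quantity to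
  -- bound; the other two absorb the term linear in w.
  have key := maxWeight_mean_le (V := fun q => w q ^ 3 / d) (f := fun q => w q ^ 2)
    (g := fun _ => (D ^ 3 + 9 / 32 * (C + D ^ 2) ^ 2 / d) / d) hα hπ
    (fun q => div_nonneg (pow_nonneg (hw q) 3) hd.le) (fun q => sq_nonneg _)
    (fun q => by positivity) fun q s hs => ?_
  · rwa [tsum_const_mul] at key
  have hpt : ∀ᵐ a ∂arrivalMeasure α, w (q + a - s) ^ 3 / d ≤
      3 / 2 * w q / d * w (q + a - s) ^ 2 +
        (w q ^ 3 - 3 / 2 * w q ^ 3 + 3 / 2 * w q * D ^ 2 + D ^ 3) / d := by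
    filter_upwards [ae_le_of_bounded hα] with a ha
    have h1 := hinc q s (Finset.mem_filter.1 hs).1 a ha
    set y := w (q + a - s) with hy
    have hy0 : 0 ≤ y := hw _
    set x := w q
    have hx0 : 0 ≤ x := hw _
    have h2 : (y - x) ^ 2 ≤ D ^ 2 := sq_le_sq' (abs_le.1 h1).1 (abs_le.1 h1).2
    have h3 : (y - x) ^ 3 ≤ D ^ 3 := by
      have : |(y - x) ^ 3| ≤ D ^ 3 := by
        rw [abs_pow]; exact pow_le_pow_left₀ (abs_nonneg _) h1 3
      exact (le_abs_self _).trans this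
    -- Expanding y = x + (y - x) gives y³ = (3/2)xy² - x³/2 + (3/2)x(y - x)² + (y - x)³, so only the
    -- drift of w² is needed.
    have h4 : y ^ 3 ≤ 3 / 2 * x * y ^ 2 +
        (x ^ 3 - 3 / 2 * x ^ 3 + 3 / 2 * x * D ^ 2 + D ^ 3) := by
      have h5 : x * (y - x) ^ 2 ≤ x * D ^ 2 := mul_le_mul_of_nonneg_left h2 hx0
      nlinarith
    calc y ^ 3 / d ≤ (3 / 2 * x * y ^ 2 +
        (x ^ 3 - 3 / 2 * x ^ 3 + 3 / 2 * x * D ^ 2 + D ^ 3)) / d := by gcongr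
      _ = _ := by ring
  refine (integral_mono_ae (integrable_arrival hα _) (integrable_arrival hα _) hpt).trans ?_
  rw [integral_add (integrable_arrival hα _) (integrable_const _), integral_const_mul,
    integral_const, probReal_univ, one_smul]
  have h1 := hdrift q s hs
  set x := w q
  have hx0 : 0 ≤ x := hw _
  have h2 : 3 / 2 * x / d * ∫ a, w (q + a - s) ^ 2 ∂arrivalMeasure α ≤
      3 / 2 * x / d * (x ^ 2 + C - 2 * d * x) := mul_le_mul_of_nonneg_left h1 (by positivity)
  refine (add_le_add_left h2 _).trans ?_
  -- Completing this square produces the constant 9/32.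
  have h3 : 0 ≤ 2 * (x - 3 * (C + D ^ 2) / (8 * d)) ^ 2 := by positivity
  refine le_of_sub_nonneg (h3.trans_eq ?_)
  field_simp
  ring

/-- Drift of the squared norm of the component orthogonal to `c`.  For `c = 0` this is the drift
of the squared norm of the queue vector. -/
theorem perp_sq_drift (hα : BoundedArrivals α Amax) (hD : IsSizeBound 𝒮 Amax D)
    (hcc : (inner ℝ c c : ℝ) • c = c) (hc : ∀ l, 0 ≤ c l) (hd : 0 ≤ d)
    {r : EuclideanSpace ℝ (Fin L)} {t : ℝ} (hr : r = rate α + t • c)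
    (hball : ∀ v : EuclideanSpace ℝ (Fin L), (inner ℝ c v : ℝ) = 0 → ‖v‖ ≤ d →
      r + v ∈ capacityRegion 𝒮)
    (hface : ∀ s ∈ 𝒮, (inner ℝ c (toVec s) : ℝ) ≤ inner ℝ c r) {q s : Fin L → ℕ}
    (hs : s ∈ maxWeightSchedules 𝒮 q) :
    ∫ a, ‖perp c (toVec (q + a - s))‖ ^ 2 ∂arrivalMeasure α ≤
      ‖perp c (toVec q)‖ ^ 2 + (2 * D) ^ 2 - 2 * d * ‖perp c (toVec q)‖ := by
  have hs𝒮 := (Finset.mem_filter.1 hs).1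
  set p := perp c (toVec q) with hp
  have hx0 := inner_toVec_nonneg hc q
  have hpt : ∀ᵐ a ∂arrivalMeasure α, ‖perp c (toVec (q + a - s))‖ ^ 2 ≤
      2 * inner ℝ p (toVec a) + (‖p‖ ^ 2 - 2 * inner ℝ p (toVec s) + (2 * D) ^ 2) := by
    filter_upwards [ae_le_of_bounded hα] with a ha
    rw [norm_perp_sq hcc]
    have h1 : ‖toVec (q + a - s)‖ ^ 2 ≤ ‖toVec q + (toVec a - toVec s)‖ ^ 2 := by
      rw [← add_sub_assoc]
      exact pow_le_pow_left₀ (norm_nonneg _) (norm_toVec_next_le q a s) 2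
    rw [norm_add_sq_real, inner_sub_right] at h1
    have h2 : ‖toVec a - toVec s‖ ^ 2 ≤ (2 * D) ^ 2 := by
      refine pow_le_pow_left₀ (norm_nonneg _) ((norm_sub_le _ _).trans ?_) 2
      linarith [hD.1 s hs𝒮, hD.2 a ha]
    have h3 : (inner ℝ c (toVec (q + a - s)) : ℝ) = inner ℝ c (toVec q) + inner ℝ c (toVec a)
        - inner ℝ c (toVec s) + inner ℝ c (toVec (s - (q + a))) := by
      rw [toVec_next, inner_add_right, inner_sub_right, inner_add_right]
    have h4 := mul_nonneg hx0 (inner_toVec_nonneg hc (s - (q + a)))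
    -- The squared workload is subtracted, so it may be replaced by its tangent at the old workload;
    -- the unused service then enters with a favourable sign.
    have h5 := sq_nonneg ((inner ℝ c (toVec (q + a - s)) : ℝ) - inner ℝ c (toVec q))
    rw [hp, norm_perp_sq hcc, inner_perp_left, inner_perp_left]
    rw [h3] at h5 ⊢
    nlinarith
  refine (integral_mono_ae (integrable_arrival hα _) (integrable_arrival hα _) hpt).trans ?_
  rw [integral_add (integrable_arrival hα _) (integrable_const _), integral_const_mul,
    integral_inner hα, integral_const, probReal_univ, one_smul]
  -- Since p is orthogonal to c, the rate may be replaced by the point r of the face.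
  have hrate : (inner ℝ p (rate α) : ℝ) = inner ℝ p r := by
    rw [hr, inner_add_right, inner_smul_right, real_inner_comm c p, inner_perp hcc, mul_zero,
      add_zero]
  -- MaxWeight is compared with r moved by d in the direction of p, which gains d‖p‖. If p = 0,
  -- division by zero makes the move 0.
  have hmax : (inner ℝ p r : ℝ) + d * ‖p‖ ≤ inner ℝ p (toVec s) := by
    have hv : (inner ℝ c ((d / ‖p‖) • p) : ℝ) = 0 := by
      rw [inner_smul_right, inner_perp hcc, mul_zero]
    have hvd : ‖(d / ‖p‖) • p‖ ≤ d := by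
      rw [norm_smul, norm_div, norm_norm, Real.norm_of_nonneg hd]
      rcases eq_or_ne ‖p‖ 0 with h0 | h0
      · simpa [h0] using hd
      · rw [div_mul_cancel₀ _ h0]
    have h1 := inner_le_of_mem_maxWeightSchedules hs (hball _ hv hvd)
    have h2 : (inner ℝ (toVec q) ((d / ‖p‖) • p) : ℝ) = d * ‖p‖ := by
      rw [inner_smul_right, hp, inner_self_perp, ← norm_perp_sq hcc, ← hp]
      rcases eq_or_ne ‖p‖ 0 with h0 | h0
      · simp [h0]
      · field_simp
    rw [inner_add_right, h2] at h1
    rw [hp, inner_perp_left, inner_perp_left]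
    have h3 := mul_le_mul_of_nonneg_left (hface s hs𝒮) hx0
    linarith
  rw [hrate]
  linarith

/-- The bound on the second moment that results from drift `d` and sizes `D`. -/
noncomputable def momentBound (D d : ℝ) : ℝ :=
  ((3 * D) ^ 3 + 9 / 32 * ((2 * D) ^ 2 + (3 * D) ^ 2) ^ 2 / d) / d

/-- State space collapse: the component orthogonal to `c` has a bounded second moment. -/
theorem perp_second_moment_le (hα : BoundedArrivals α Amax) {π : PMF (Fin L → ℕ)}
    (hπ : π.bind (maxWeightStep 𝒮 h𝒮 α) = π) (hD0 : 0 ≤ D) (hD : IsSizeBound 𝒮 Amax D)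
    (hcc : (inner ℝ c c : ℝ) • c = c) (hc : ∀ l, 0 ≤ c l) (hd : 0 < d)
    {r : EuclideanSpace ℝ (Fin L)} {t : ℝ} (hr : r = rate α + t • c)
    (hball : ∀ v : EuclideanSpace ℝ (Fin L), (inner ℝ c v : ℝ) = 0 → ‖v‖ ≤ d →
      r + v ∈ capacityRegion 𝒮)
    (hface : ∀ s ∈ 𝒮, (inner ℝ c (toVec s) : ℝ) ≤ inner ℝ c r) :
    ∑' q, π q * ENNReal.ofReal (‖perp c (toVec q)‖ ^ 2) ≤ ENNReal.ofReal (momentBound D d) := by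
  refine second_moment_le (w := fun q => ‖perp c (toVec q)‖) (D := 3 * D) hα hπ
    (fun q => norm_nonneg _) (by positivity) hd (fun q s hs a ha => ?_) fun q s hs =>
      perp_sq_drift hα hD hcc hc hd.le hr hball hface hs
  refine (abs_norm_sub_norm_le _ _).trans ?_
  rw [← perp_sub]
  exact (norm_perp_le hcc _).trans (norm_toVec_next_sub_le hD hs ha)

theorem exists_ball_of_mem_interior {r : EuclideanSpace ℝ (Fin L)}
    (hr : r ∈ interior (capacityRegion 𝒮)) :
    ∃ d > 0, ∀ v : EuclideanSpace ℝ (Fin L), ‖v‖ ≤ d → r + v ∈ capacityRegion 𝒮 := by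
  obtain ⟨δ, hδ, hball⟩ := Metric.isOpen_iff.1 isOpen_interior r hr
  refine ⟨δ / 2, by positivity, fun v hv => interior_subset (hball ?_)⟩
  rw [Metric.mem_ball, dist_eq_norm, add_sub_cancel_left]
  linarith

/-- Under MaxWeight the second moment of the queue vector is finite. -/
theorem second_moment_ne_top (hα : BoundedArrivals α Amax)
    (hrate : rate α ∈ interior (capacityRegion 𝒮)) {π : PMF (Fin L → ℕ)}
    (hπ : π.bind (maxWeightStep 𝒮 h𝒮 α) = π) :
    ∑' q, π q * ENNReal.ofReal (‖toVec q‖ ^ 2) ≠ ⊤ := by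
  obtain ⟨D, hD0, hD⟩ := exists_isSizeBound 𝒮 Amax
  obtain ⟨d, hd, hball⟩ := exists_ball_of_mem_interior hrate
  -- With c = 0 the orthogonal part is all of the queue vector, and the ball is one around the rate
  -- itself.
  have := perp_second_moment_le (c := 0) (r := rate α) (t := 0) hα hπ hD0 hD (by simp)
    (fun l => by simp) hd (by simp) (fun v _ hv => hball v hv) fun s _ => by simp
  simp only [perp, smul_zero, sub_zero] at this
  exact ne_top_of_le_ne_top ENNReal.ofReal_ne_top this

theorem finite_setOf_norm_toVec_le (M : ℝ) : {q : Fin L → ℕ | ‖toVec q‖ ≤ M}.Finite := by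
  refine (Set.finite_Iic (fun _ : Fin L => ⌊M⌋₊)).subset fun q hq l => ?_
  refine Nat.le_floor ?_
  have h1 := PiLp.norm_apply_le (toVec q) l
  have h2 : ‖toVec q l‖ = q l := by simp [toVec]
  rw [← h2]
  exact h1.trans hq

/-- Foster's criterion for the squared norm: an interior rate gives drift -2d‖q‖ up to a constant,
and balls contain finitely many integer points. -/
theorem exists_isMaxWeightSteadyState (hα : BoundedArrivals α Amax)
    (hrate : rate α ∈ interior (capacityRegion 𝒮)) :
    ∃ π, IsMaxWeightSteadyState 𝒮 h𝒮 α π := by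
  obtain ⟨D, hD0, hD⟩ := exists_isSizeBound 𝒮 Amax
  obtain ⟨d, hd, hball⟩ := exists_ball_of_mem_interior hrate
  suffices h : ∃ π : PMF (Fin L → ℕ), π.bind (maxWeightStep 𝒮 h𝒮 α) = π from
    h.imp fun π hπ => isMaxWeightSteadyState_of_bind_eq hπ
  refine exists_stationary (V := fun q => ENNReal.ofReal (‖toVec q‖ ^ 2))
    (f := fun q => ENNReal.ofReal (2 * d * ‖toVec q‖)) (C := ((2 * D) ^ 2).toNNReal) 0
    ENNReal.ofReal_ne_top (fun M => ?_) fun q => ?_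
  · refine (finite_setOf_norm_toVec_le (M / (2 * d))).subset fun q hq => ?_
    have hq' : ENNReal.ofReal (2 * d * ‖toVec q‖) ≤ M := hq
    rw [ENNReal.ofReal_le_coe] at hq'
    rw [Set.mem_ofPred_eq, le_div_iff₀ (by positivity)]
    linarith
  · refine maxWeight_drift (V := fun q => ‖toVec q‖ ^ 2) (f := fun q => 2 * d * ‖toVec q‖)
      (g := fun _ => (2 * D) ^ 2) hα (fun q => sq_nonneg _) (fun q => by positivity)
      (fun _ => sq_nonneg _) fun s hs => ?_
    have := perp_sq_drift (c := 0) (r := rate α) (t := 0) hα hD (by simp)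
      (fun l => by simp) hd.le (by simp) (fun v _ hv => hball v hv) (fun s _ => by simp) hs
    simpa only [perp, inner_zero_left, smul_zero, sub_zero] using this

end Moments

end MaxWeight

namespace MaxWeight

variable {L K : ℕ}

/-! ## First moment bounds under MaxWeight -/

section FirstMoment

variable {𝒮 : Finset (Fin L → ℕ)} {h𝒮 : 𝒮.Nonempty} {α : Fin L → PMF ℕ} {Amax : ℕ}
  {c : EuclideanSpace ℝ (Fin L)} {b D κ : ℝ}

theorem zeta_nonneg (c : EuclideanSpace ℝ (Fin L)) (α : Fin L → PMF ℕ) :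
    0 ≤ zeta c (arrivalVar α) :=
  Finset.sum_nonneg fun _ _ => mul_nonneg (sq_nonneg _) (variance_nonneg _ _)

theorem meanWorkload_eq_tsum (c : EuclideanSpace ℝ (Fin L)) (π : PMF (Fin L → ℕ)) :
    meanWorkload c π = ∑' q, π q * ENNReal.ofReal (inner ℝ c (toVec q)) := by
  rw [meanWorkload, tsum_mul_eq_lintegral]

theorem norm_le_of_mem_capacityRegion (hD : IsSizeBound 𝒮 Amax D)
    {r : EuclideanSpace ℝ (Fin L)} (hr : r ∈ capacityRegion 𝒮) : ‖r‖ ≤ D := by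
  have : capacityRegion 𝒮 ⊆ Metric.closedBall 0 D := by
    refine convexHull_min ?_ (convex_closedBall _ _)
    rintro _ ⟨s, hs, rfl⟩
    simpa using hD.1 s hs
  simpa using this hr

theorem inner_unused_le (hc : ∀ l, 0 ≤ c l) (q a s : Fin L → ℕ) :
    (inner ℝ c (toVec (s - (q + a))) : ℝ) ≤ inner ℝ c (toVec s) := by
  rw [inner_toVec, inner_toVec]
  refine Finset.sum_le_sum fun l _ => mul_le_mul_of_nonneg_left ?_ (hc l)
  exact_mod_cast Nat.sub_le _ _

/-- Queues with unused service are empty, so that the unused service is controlled by the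
orthogonal component. -/
theorem inner_mul_unused_le (hc : ∀ l, 0 ≤ c l) {G : ℝ} (hG : ∀ l, 0 < c l → 1 ≤ G * c l)
    (hκ : 0 < κ) {q a s : Fin L → ℕ} (hs : ‖toVec s‖ ≤ D) :
    (inner ℝ c (toVec (q + a - s)) : ℝ) * inner ℝ c (toVec (s - (q + a))) ≤
      κ * ‖perp c (toVec (q + a - s))‖ ^ 2 +
        D * G / (4 * κ) * inner ℝ c (toVec (s - (q + a))) := by
  set x : ℝ := inner ℝ c (toVec (q + a - s)) with hx
  set p := perp c (toVec (q + a - s)) with hp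
  rw [EuclideanSpace.norm_sq_eq, inner_toVec, Finset.mul_sum, Finset.mul_sum, Finset.mul_sum,
    ← Finset.sum_add_distrib]
  refine Finset.sum_le_sum fun l _ => ?_
  set u : ℝ := (((s - (q + a)) l : ℕ) : ℝ) with hu
  have hu0 : 0 ≤ u := Nat.cast_nonneg _
  rw [Real.norm_eq_abs, sq_abs]
  rcases (hc l).eq_or_lt' with h0 | hpos
  · simp only [h0, zero_mul, mul_zero, add_zero]
    positivity
  rcases hu0.eq_or_lt' with h0 | hupos
  · simp only [h0, mul_zero, add_zero]
    positivity
  have hq0 : toVec (q + a - s) l = 0 := by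
    have h1 : 0 < (s - (q + a)) l := Nat.cast_pos.1 hupos
    have h2 : (q + a - s) l = 0 := by
      simp only [Pi.sub_apply, Pi.add_apply] at h1 ⊢
      omega
    simpa [toVec] using h2
  -- At an empty queue the orthogonal component is exactly -x c_l, so x c_l u = -p_l u, and Young's
  -- inequality applies.
  have hpl : p l = -(x * c l) := by
    simp only [hp, perp, PiLp.sub_apply, PiLp.smul_apply, hq0, smul_eq_mul, zero_sub, ← hx]
  have huD : u ≤ D := by
    have h1 : u ≤ toVec s l := by
      simp only [hu, toVec, Pi.sub_apply]
      exact_mod_cast Nat.sub_le _ _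
    have h2 := PiLp.norm_apply_le (toVec s) l
    rw [Real.norm_eq_abs] at h2
    exact h1.trans ((le_abs_self _).trans (h2.trans hs))
  have h1 : u ^ 2 ≤ D * G * (c l * u) := by
    have h2 : u * u ≤ D * u := mul_le_mul_of_nonneg_right huD hu0
    have h3 : D * u * 1 ≤ D * u * (G * c l) :=
      mul_le_mul_of_nonneg_left (hG l hpos) (mul_nonneg (hu0.trans huD) hu0)
    nlinarith
  have h2 : x * (c l * u) = -p l * u := by rw [hpl]; ring
  have h3 : D * G / (4 * κ) * (c l * u) = D * G * (c l * u) / (4 * κ) := by ring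
  rw [h2, h3]
  have h4 : u ^ 2 / (4 * κ) ≤ D * G * (c l * u) / (4 * κ) := by gcongr
  have h5 : κ * p l ^ 2 + u ^ 2 / (4 * κ) - -p l * u = κ * (p l + u / (2 * κ)) ^ 2 := by
    field_simp
    ring
  have h6 : 0 ≤ κ * (p l + u / (2 * κ)) ^ 2 := by positivity
  linarith

/-- MaxWeight serves off the face only if the workload is of the order of the orthogonal
component. -/
theorem inner_mul_deficit_le (hD : IsSizeBound 𝒮 Amax D) {G : ℝ}
    (hG : ∀ s ∈ 𝒮, 0 < b - inner ℝ c (toVec s) → 1 ≤ G * (b - inner ℝ c (toVec s)))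
    (hb : ∀ s ∈ 𝒮, (inner ℝ c (toVec s) : ℝ) ≤ b) (hκ : 0 < κ)
    {r : EuclideanSpace ℝ (Fin L)} (hr : r ∈ capacityRegion 𝒮) (hrb : inner ℝ c r = b)
    {q s : Fin L → ℕ} (hs : s ∈ maxWeightSchedules 𝒮 q) :
    (inner ℝ c (toVec q) : ℝ) * (b - inner ℝ c (toVec s)) ≤
      κ * ‖perp c (toVec q)‖ ^ 2 + D ^ 2 * G / κ * (b - inner ℝ c (toVec s)) := by
  have hs𝒮 := (Finset.mem_filter.1 hs).1
  rcases (sub_nonneg.2 (hb s hs𝒮)).eq_or_lt' with h0 | hpos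
  · rw [h0, mul_zero, mul_zero, add_zero]
    positivity
  have h1 := inner_le_of_mem_maxWeightSchedules hs hr
  -- The weight gained over r is nonnegative, so the workload times the deficit is at most ⟨perp, s
  -- - r⟩, hence at most 2D‖perp‖.
  have h2 : (inner ℝ (perp c (toVec q)) (toVec s - r) : ℝ) =
      inner ℝ (toVec q) (toVec s) - inner ℝ (toVec q) r
        + inner ℝ c (toVec q) * (b - inner ℝ c (toVec s)) := by
    rw [inner_perp_left, inner_sub_right, inner_sub_right, hrb]; ring
  have h3 := real_inner_le_norm (perp c (toVec q)) (toVec s - r)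
  set w := ‖perp c (toVec q)‖
  have hw : 0 ≤ w := norm_nonneg _
  have h4 : ‖toVec s - r‖ ≤ 2 * D := by
    have := norm_sub_le (toVec s) r
    linarith [hD.1 s hs𝒮, norm_le_of_mem_capacityRegion hD hr]
  have h5 : w * ‖toVec s - r‖ ≤ w * (2 * D) := mul_le_mul_of_nonneg_left h4 hw
  -- A positive deficit is at least 1 / G, so the constant from Young's inequality can be charged to
  -- the deficit.
  have h6 : D ^ 2 * 1 / κ ≤ D ^ 2 * (G * (b - inner ℝ c (toVec s))) / κ := by
    gcongr
    exact hG s hs𝒮 hpos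
  have h7 : κ * w ^ 2 + D ^ 2 * 1 / κ - w * (2 * D) = κ * (w - D / κ) ^ 2 := by
    field_simp
    ring
  have h8 : 0 ≤ κ * (w - D / κ) ^ 2 := by positivity
  have h9 : D ^ 2 * G / κ * (b - inner ℝ c (toVec s)) =
    D ^ 2 * (G * (b - inner ℝ c (toVec s))) / κ := by ring
  rw [h9]
  linarith

/-- Finitely many positive numbers are bounded away from zero; the sum of all reciprocals is a crude
common constant. -/
theorem exists_deficit_bound (𝒮 : Finset (Fin L → ℕ)) (c : EuclideanSpace ℝ (Fin L)) (b : ℝ) :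
    ∃ G : ℝ, 0 ≤ G ∧ (∀ l, 0 < c l → 1 ≤ G * c l) ∧
      ∀ s ∈ 𝒮, 0 < b - inner ℝ c (toVec s) → 1 ≤ G * (b - inner ℝ c (toVec s)) := by
  have h1 : 0 ≤ ∑ l, |c l|⁻¹ := Finset.sum_nonneg fun _ _ => inv_nonneg.2 (abs_nonneg _)
  have h2 : 0 ≤ ∑ s ∈ 𝒮, |b - inner ℝ c (toVec s)|⁻¹ :=
    Finset.sum_nonneg fun _ _ => inv_nonneg.2 (abs_nonneg _)
  refine ⟨∑ l, |c l|⁻¹ + ∑ s ∈ 𝒮, |b - inner ℝ c (toVec s)|⁻¹, add_nonneg h1 h2,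
    fun l hl => ?_, fun s hs hpos => ?_⟩
  · rw [← div_le_iff₀ hl, one_div]
    have := Finset.single_le_sum (f := fun l => |c l|⁻¹)
      (fun _ _ => inv_nonneg.2 (abs_nonneg _)) (Finset.mem_univ l)
    rw [abs_of_pos hl] at this
    linarith
  · rw [← div_le_iff₀ hpos, one_div]
    have := Finset.single_le_sum (f := fun s => |b - inner ℝ c (toVec s)|⁻¹)
      (fun _ _ => inv_nonneg.2 (abs_nonneg _)) hs
    rw [abs_of_pos hpos] at this
    linarith

theorem inner_next (c : EuclideanSpace ℝ (Fin L)) (b : ℝ) (q a s : Fin L → ℕ) :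
    (inner ℝ c (toVec (q + a - s)) : ℝ) = inner ℝ c (toVec q) + (inner ℝ c (toVec a) - b) +
      (b - inner ℝ c (toVec s)) + inner ℝ c (toVec (s - (q + a))) := by
  rw [toVec_next, inner_add_right, inner_sub_right, inner_add_right]
  ring

/-- Drift of the shifted square of the workload, which also accounts for the unused service and
for the service off the face. -/
theorem workload_drift (hα : BoundedArrivals α Amax) (hD0 : 0 ≤ D) (hD : IsSizeBound 𝒮 Amax D)
    (hc1 : ‖c‖ = 1) (hc : ∀ l, 0 ≤ c l) (hb0 : 0 ≤ b)
    (hb : ∀ s ∈ 𝒮, (inner ℝ c (toVec s) : ℝ) ≤ b) {G M : ℝ} (hG0 : 0 ≤ G)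
    (hG : ∀ l, 0 < c l → 1 ≤ G * c l)
    (hG' : ∀ s ∈ 𝒮, 0 < b - inner ℝ c (toVec s) → 1 ≤ G * (b - inner ℝ c (toVec s)))
    (hκ : 0 < κ) (hM : M = (D * G + 2 * D ^ 2 * G) / κ + 2 * D)
    {r : EuclideanSpace ℝ (Fin L)} (hr : r ∈ capacityRegion 𝒮) (hrb : inner ℝ c r = b)
    {q s : Fin L → ℕ} (hs : s ∈ maxWeightSchedules 𝒮 q) {ε : ℝ}
    (hε : ε = b - inner ℝ c (rate α)) :
    ∫ a, ((inner ℝ c (toVec (q + a - s)) : ℝ) - M / 2) ^ 2 ∂arrivalMeasure α ≤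
      ((inner ℝ c (toVec q) : ℝ) - M / 2) ^ 2 + (zeta c (arrivalVar α) + ε ^ 2 + M * ε +
        36 * κ * D ^ 2 + 6 * κ * ‖perp c (toVec q)‖ ^ 2) - 2 * ε * inner ℝ c (toVec q) := by
  have hs𝒮 := (Finset.mem_filter.1 hs).1
  have hcc : (inner ℝ c c : ℝ) • c = c := by
    rw [real_inner_self_eq_norm_sq, hc1, one_pow, one_smul]
  have hβ := inner_mul_deficit_le hD hG' hb hκ hr hrb hs
  have hβ0 : 0 ≤ b - inner ℝ c (toVec s) := sub_nonneg.2 (hb s hs𝒮)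
  have hβb : b - inner ℝ c (toVec s) ≤ b := by linarith [inner_toVec_nonneg hc s]
  set x : ℝ := inner ℝ c (toVec q) with hx
  set β : ℝ := b - inner ℝ c (toVec s) with hβdef
  set w := ‖perp c (toVec q)‖ with hw
  have hpt : ∀ᵐ a ∂arrivalMeasure α, ((inner ℝ c (toVec (q + a - s)) : ℝ) - M / 2) ^ 2 ≤
      (2 * x - M) * (inner ℝ c (toVec a)) + (inner ℝ c (toVec a) - b) ^ 2 +
        ((x - M / 2) ^ 2 - (2 * x - M) * b + 36 * κ * D ^ 2 + 6 * κ * w ^ 2) := by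
    filter_upwards [ae_le_of_bounded hα] with a ha
    have hυ := inner_mul_unused_le (q := q) (a := a) hc hG hκ (hD.1 s hs𝒮)
    have hυ0 := inner_toVec_nonneg hc (s - (q + a))
    -- From (w + 3D)² ≤ 2w² + 18D². It yields the constant 36; the 6 is 4 from here plus 2 from the
    -- deficit term.
    have hw' : ‖perp c (toVec (q + a - s))‖ ^ 2 ≤ 2 * w ^ 2 + 18 * D ^ 2 := by
      have h1 : ‖perp c (toVec (q + a - s))‖ ≤ w + 3 * D := by
        have h2 := norm_le_norm_add_norm_sub' (perp c (toVec (q + a - s))) (perp c (toVec q))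
        rw [← perp_sub] at h2
        have h3 := (norm_perp_le hcc _).trans (norm_toVec_next_sub_le (q := q) hD hs𝒮 ha)
        linarith
      have h2 := pow_le_pow_left₀ (norm_nonneg _) h1 2
      nlinarith [sq_nonneg (w - 3 * D)]
    have haD : (inner ℝ c (toVec a) : ℝ) ≤ D := by
      have := real_inner_le_norm c (toVec a)
      rw [hc1, one_mul] at this
      exact this.trans (hD.2 a ha)
    have hnext := inner_next c b q a s
    set υ : ℝ := inner ℝ c (toVec (s - (q + a))) with hυdef
    set x' : ℝ := inner ℝ c (toVec (q + a - s)) with hx'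
    set y : ℝ := inner ℝ c (toVec a) with hy
    rw [← hx, ← hβdef] at hnext
    have e1 : κ * ‖perp c (toVec (q + a - s))‖ ^ 2 ≤ κ * (2 * w ^ 2 + 18 * D ^ 2) :=
      mul_le_mul_of_nonneg_left hw' hκ.le
    have e2 : 2 * (y - b) * β + β ^ 2 ≤ 2 * D * β := by nlinarith
    have e3 : x' ^ 2 = (x + (y - b) + β) ^ 2 + 2 * (x' * υ) - υ ^ 2 := by rw [hnext]; ring
    -- M is chosen to dominate the coefficients of both υ and β. Their sum is the workload increment
    -- minus (y - b), which the linear term of the shifted square cancels.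
    have e4 : 2 * (D * G / (4 * κ)) * υ + (2 * (D ^ 2 * G / κ) + 2 * D) * β ≤ M * (υ + β) := by
      have h1 : 2 * (D * G / (4 * κ)) ≤ M := by
        have : 0 ≤ D * G / κ := by positivity
        have : 0 ≤ D ^ 2 * G / κ := by positivity
        have h3 : 2 * (D * G / (4 * κ)) = D * G / κ / 2 := by field_simp; ring
        have h4 : (D * G + 2 * D ^ 2 * G) / κ = D * G / κ + 2 * (D ^ 2 * G / κ) := by ring
        rw [h3, hM, h4]
        linarith
      have h2 : 2 * (D ^ 2 * G / κ) + 2 * D ≤ M := by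
        have : 0 ≤ D * G / κ := by positivity
        have h4 : (D * G + 2 * D ^ 2 * G) / κ = D * G / κ + 2 * (D ^ 2 * G / κ) := by ring
        rw [hM, h4]
        linarith
      have := mul_le_mul_of_nonneg_right h1 hυ0
      have := mul_le_mul_of_nonneg_right h2 hβ0
      linarith
    have e5 : υ + β = x' - x - (y - b) := by rw [hnext]; ring
    rw [e5] at e4
    have e6 := sq_nonneg υ
    have e7 : (x' - M / 2) ^ 2 = x' ^ 2 - M * x' + M ^ 2 / 4 := by ring
    rw [e7, e3]
    have e8 : (x + (y - b) + β) ^ 2 = x ^ 2 + 2 * x * (y - b) + (y - b) ^ 2 + 2 * (x * β) +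
      (2 * (y - b) * β + β ^ 2) := by ring
    rw [e8]
    linear_combination 2 * hυ + 2 * hβ + 2 * e1 + e2 + e4 + e6
  refine (integral_mono_ae (integrable_arrival hα _) (integrable_arrival hα _) hpt).trans ?_
  rw [integral_add (f := fun a => (2 * x - M) * (inner ℝ c (toVec a)) +
      (inner ℝ c (toVec a) - b) ^ 2) (integrable_arrival hα _) (integrable_const _),
    integral_add (integrable_arrival hα _) (integrable_arrival hα _), integral_const_mul,
    integral_inner hα, integral_sq hα, integral_const, probReal_univ, one_smul]
  have : (inner ℝ c (rate α) : ℝ) = b - ε := by rw [hε]; ring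
  rw [this]
  apply le_of_eq
  ring

/-- The first moment bound under MaxWeight, from a bound on the orthogonal component. -/
theorem mul_meanWorkload_le (hα : BoundedArrivals α Amax) {π : PMF (Fin L → ℕ)}
    (hπ : π.bind (maxWeightStep 𝒮 h𝒮 α) = π) (hD0 : 0 ≤ D) (hD : IsSizeBound 𝒮 Amax D)
    (hc1 : ‖c‖ = 1) (hc : ∀ l, 0 ≤ c l) (hb0 : 0 ≤ b)
    (hb : ∀ s ∈ 𝒮, (inner ℝ c (toVec s) : ℝ) ≤ b) {G : ℝ} (hG0 : 0 ≤ G)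
    (hG : ∀ l, 0 < c l → 1 ≤ G * c l)
    (hG' : ∀ s ∈ 𝒮, 0 < b - inner ℝ c (toVec s) → 1 ≤ G * (b - inner ℝ c (toVec s)))
    {r : EuclideanSpace ℝ (Fin L)} (hr : r ∈ capacityRegion 𝒮) (hrb : inner ℝ c r = b)
    {ε : ℝ} (hε0 : 0 < ε) (hε : ε = b - inner ℝ c (rate α)) {N : ℝ} (hN0 : 0 ≤ N)
    (hN : ∑' q, π q * ENNReal.ofReal (‖perp c (toVec q)‖ ^ 2) ≤ ENNReal.ofReal N) :
    ENNReal.ofReal (2 * ε) * meanWorkload c π ≤ ENNReal.ofReal (zeta c (arrivalVar α) +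
      (ε ^ 2 + 2 * D * ε + (D * G + 2 * D ^ 2 * G + 36 * D ^ 2 + 6 * N) * √ε)) := by
  -- The choice κ = √ε balances the errors of order κ and of order Mε ≈ ε / κ.
  have hκ : 0 < √ε := Real.sqrt_pos.2 hε0
  set M := (D * G + 2 * D ^ 2 * G) / √ε + 2 * D with hM
  have hM0 : 0 ≤ M := by positivity
  have hζ := zeta_nonneg c α
  have key := maxWeight_mean_le (V := fun q => ((inner ℝ c (toVec q) : ℝ) - M / 2) ^ 2)
    (f := fun q => 2 * ε * inner ℝ c (toVec q))
    (g := fun q => zeta c (arrivalVar α) + ε ^ 2 + M * ε + 36 * √ε * D ^ 2 +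
      6 * √ε * ‖perp c (toVec q)‖ ^ 2) hα hπ
    (fun q => sq_nonneg _) (fun q => mul_nonneg (by positivity) (inner_toVec_nonneg hc q))
    (fun q => by positivity) fun q s hs =>
      workload_drift hα hD0 hD hc1 hc hb0 hb hG0 hG hG' hκ hM hr hrb hs hε
  have h1 : ∀ q : Fin L → ℕ, π q * ENNReal.ofReal (2 * ε * inner ℝ c (toVec q)) =
      ENNReal.ofReal (2 * ε) * (π q * ENNReal.ofReal (inner ℝ c (toVec q))) := fun q => by
    rw [ENNReal.ofReal_mul (by positivity)]; ring
  have h2 : ∀ q : Fin L → ℕ, ENNReal.ofReal (zeta c (arrivalVar α) + ε ^ 2 + M * ε +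
      36 * √ε * D ^ 2 + 6 * √ε * ‖perp c (toVec q)‖ ^ 2) =
      ENNReal.ofReal (zeta c (arrivalVar α) + ε ^ 2 + M * ε + 36 * √ε * D ^ 2) +
        ENNReal.ofReal (6 * √ε) * ENNReal.ofReal (‖perp c (toVec q)‖ ^ 2) := fun q => by
    rw [ENNReal.ofReal_add (by positivity) (by positivity), ENNReal.ofReal_mul (by positivity)]
  simp only [h1, h2] at key
  rw [ENNReal.tsum_mul_left, ← meanWorkload_eq_tsum, tsum_mul_add, tsum_const_mul] at key
  simp only [mul_left_comm (π _)] at key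
  rw [ENNReal.tsum_mul_left] at key
  refine key.trans ((add_le_add_right (mul_le_mul_right hN _) _).trans (le_of_eq ?_))
  rw [← ENNReal.ofReal_mul (by positivity), ← ENNReal.ofReal_add (by positivity) (by positivity)]
  congr 1
  have hs : √ε * √ε = ε := Real.mul_self_sqrt hε0.le
  have hMε : M * ε = (D * G + 2 * D ^ 2 * G) * √ε + 2 * D * ε := by
    rw [hM, add_mul, div_mul_eq_mul_div, mul_div_assoc, Real.div_sqrt]
  rw [hMε]
  ring

/-- The universal lower bound for the first moment, for stationary laws of MaxWeight. -/
theorem zeta_le_mul_meanWorkload (hα : BoundedArrivals α Amax)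
    (hrate : rate α ∈ interior (capacityRegion 𝒮)) {π : PMF (Fin L → ℕ)}
    (hπ : π.bind (maxWeightStep 𝒮 h𝒮 α) = π)
    (hc1 : ‖c‖ = 1) (hc : ∀ l, 0 ≤ c l) (hb0 : 0 ≤ b)
    (hb : ∀ s ∈ 𝒮, (inner ℝ c (toVec s) : ℝ) ≤ b)
    {ε : ℝ} (hε0 : 0 < ε) (hε : ε = b - inner ℝ c (rate α)) :
    ENNReal.ofReal (zeta c (arrivalVar α)) ≤
      ENNReal.ofReal (2 * ε) * meanWorkload c π + ENNReal.ofReal (b * ε) := by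
  -- The linear term bx supplies bυ, which pays for the loss -υ² because υ ≤ b.
  set V : (Fin L → ℕ) → ℝ := fun q =>
    (inner ℝ c (toVec q) : ℝ) ^ 2 + b * inner ℝ c (toVec q) with hV
  have hx0 : ∀ q : Fin L → ℕ, 0 ≤ (inner ℝ c (toVec q) : ℝ) := inner_toVec_nonneg hc
  have hV0 : ∀ q, 0 ≤ V q := fun q => add_nonneg (sq_nonneg _) (mul_nonneg hb0 (hx0 q))
  have hζ := zeta_nonneg c α
  have hstep : ∀ q, ENNReal.ofReal (V q) + ENNReal.ofReal (zeta c (arrivalVar α)) ≤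
      ∑' y, maxWeightStep 𝒮 h𝒮 α q y * ENNReal.ofReal (V y) +
        (ENNReal.ofReal (2 * ε) * ENNReal.ofReal (inner ℝ c (toVec q)) +
          ENNReal.ofReal (b * ε)) := by
    intro q
    set x : ℝ := inner ℝ c (toVec q) with hx
    have h1 : ENNReal.ofReal (V q + zeta c (arrivalVar α) - (2 * ε * x + b * ε)) ≤
        ∑' y, maxWeightStep 𝒮 h𝒮 α q y * ENNReal.ofReal (V y) := by
      refine le_tsum_maxWeightStep hα hV0 fun s hs => ?_
      have hs𝒮 := (Finset.mem_filter.1 hs).1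
      have hpt : ∀ a : Fin L → ℕ, (2 * x + b) * inner ℝ c (toVec a) +
          (inner ℝ c (toVec a) - inner ℝ c (toVec s)) ^ 2 +
            (V q - (2 * x + b) * b) ≤ V (q + a - s) := by
        intro a
        have hnext := inner_next c b q a s
        have h1 := inner_toVec_nonneg hc (s - (q + a))
        have h2 := (inner_unused_le hc q a s).trans (hb s hs𝒮)
        have h3 := hb s hs𝒮
        have h4 := hx0 (q + a - s)
        simp only [hV]
        rw [← hx] at hnext ⊢
        set υ : ℝ := inner ℝ c (toVec (s - (q + a)))
        set x' : ℝ := inner ℝ c (toVec (q + a - s))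
        set y : ℝ := inner ℝ c (toVec a)
        set σ : ℝ := inner ℝ c (toVec s)
        have h5 : 0 ≤ x * (b - σ) := mul_nonneg (hx0 q) (by linarith)
        have h6 : 0 ≤ b * (b - σ) := mul_nonneg hb0 (by linarith)
        have h7 : 0 ≤ υ * (b - υ) := mul_nonneg h1 (by linarith)
        have h8 : 0 ≤ x' * υ := mul_nonneg h4 h1
        have h9 : x' ^ 2 = (x + (y - b) + (b - σ)) ^ 2 + 2 * (x' * υ) - υ ^ 2 := by
          rw [hnext]; ring
        have h10 : b * x' = b * x + b * (y - b) + b * (b - σ) + b * υ := by rw [hnext]; ring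
        rw [h9, h10]
        nlinarith
      refine le_trans ?_ (integral_mono (integrable_arrival hα _) (integrable_arrival hα _) hpt)
      rw [integral_add (f := fun a => (2 * x + b) * (inner ℝ c (toVec a)) +
          (inner ℝ c (toVec a) - inner ℝ c (toVec s)) ^ 2) (integrable_arrival hα _)
          (integrable_const _),
        integral_add (integrable_arrival hα _) (integrable_arrival hα _), integral_const_mul,
        integral_inner hα, integral_sq hα, integral_const, probReal_univ, one_smul]
      have : (inner ℝ c (rate α) : ℝ) = b - ε := by rw [hε]; ring
      rw [this]
      nlinarith [sq_nonneg (b - ε - inner ℝ c (toVec s))]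
    refine le_trans ?_ (add_le_add_left h1 _)
    rw [← ENNReal.ofReal_mul (by positivity), ← ENNReal.ofReal_add (hV0 q) hζ,
      ← ENNReal.ofReal_add (mul_nonneg (by positivity) (hx0 q)) (by positivity)]
    refine le_trans (le_of_eq ?_) ENNReal.ofReal_add_le
    congr 1
    ring
  have hsum := tsum_mul_mono π hstep
  simp only [tsum_mul_add, tsum_const_mul] at hsum
  rw [← tsum_bind_mul, hπ] at hsum
  simp only [mul_left_comm (π _)] at hsum
  rw [ENNReal.tsum_mul_left, ← meanWorkload_eq_tsum] at hsum
  refine (ENNReal.add_le_add_iff_left ?_).1 hsum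
  -- V must have finite mean before it can be cancelled.
  have hfin := second_moment_ne_top hα hrate hπ
  have hle : ∀ q, ENNReal.ofReal (V q) ≤
      ENNReal.ofReal (1 + b) * ENNReal.ofReal (‖toVec q‖ ^ 2) + ENNReal.ofReal b := by
    intro q
    rw [← ENNReal.ofReal_mul (by positivity), ← ENNReal.ofReal_add (by positivity) hb0]
    refine ENNReal.ofReal_le_ofReal ?_
    have h1 := real_inner_le_norm c (toVec q)
    rw [hc1, one_mul] at h1
    have h2 := pow_le_pow_left₀ (hx0 q) h1 2
    have h3 : ‖toVec q‖ ≤ ‖toVec q‖ ^ 2 + 1 := by nlinarith [sq_nonneg (‖toVec q‖ - 1)]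
    have h4 := mul_le_mul_of_nonneg_left (h1.trans h3) hb0
    simp only [hV]
    linarith
  refine ne_top_of_le_ne_top ?_ (tsum_mul_mono π hle)
  rw [tsum_mul_add, tsum_const_mul]
  simp only [mul_left_comm (π _)]
  rw [ENNReal.tsum_mul_left]
  exact ENNReal.add_ne_top.2 ⟨ENNReal.mul_ne_top ENNReal.ofReal_ne_top hfin,
    ENNReal.ofReal_ne_top⟩

end FirstMoment

end MaxWeight

namespace MaxWeight

variable {L K : ℕ}

/-! ## A lower bound under every feasible policy -/

/-- Lindley's recursion, started from an empty queue. -/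
noncomputable def lindley {Ω : Type*} (Y : ℕ → Ω → ℝ) : ℕ → Ω → ℝ
  | 0 => fun _ => 0
  | t + 1 => fun ω => max (lindley Y t ω + Y t ω) 0

section Lindley

variable {Ω : Type*} {mΩ : MeasurableSpace Ω} {P : Measure Ω}
  {Y : ℕ → Ω → ℝ} {D ε b : ℝ}

theorem lindley_nonneg (Y : ℕ → Ω → ℝ) (t : ℕ) (ω : Ω) : 0 ≤ lindley Y t ω := by
  cases t with
  | zero => exact le_rfl
  | succ t => exact le_max_right _ _

theorem measurable_lindley_natural (hY : ∀ t, StronglyMeasurable (Y t)) (t : ℕ) :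
    Measurable[Filtration.natural Y hY t] (lindley Y (t + 1)) := by
  induction t with
  | zero =>
    exact ((measurable_const (a := (0 : ℝ))).add
      (Filtration.stronglyAdapted_natural hY 0).measurable).max measurable_const
  | succ t ih =>
    exact ((ih.mono ((Filtration.natural Y hY).mono (Nat.le_succ t)) le_rfl).add
      (Filtration.stronglyAdapted_natural hY (t + 1)).measurable).max measurable_const

theorem measurable_lindley (hY : ∀ t, Measurable (Y t)) (t : ℕ) : Measurable (lindley Y t) := by
  induction t with
  | zero => exact measurable_const
  | succ t ih => exact (ih.add (hY t)).max measurable_const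

theorem lindley_ae_le (hD : ∀ t, ∀ᵐ ω ∂P, |Y t ω| ≤ D) (t : ℕ) :
    ∀ᵐ ω ∂P, lindley Y t ω ≤ t * D := by
  induction t with
  | zero => exact Eventually.of_forall fun ω => by simp [lindley]
  | succ t ih =>
    filter_upwards [ih, hD t] with ω h1 h2
    have h3 := (abs_nonneg _).trans h2
    have h4 := le_of_abs_le h2
    refine max_le ?_ (by positivity)
    push_cast
    linarith

variable [IsProbabilityMeasure P]

/-- The recursion at time t uses only the increments before t. -/
theorem indepFun_lindley (hY : ∀ t, Measurable (Y t)) (hind : iIndepFun Y P) (t : ℕ) :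
    lindley Y t ⟂ᵢ[P] Y t := by
  cases t with
  | zero => exact indepFun_const_left (0 : ℝ) (Y 0)
  | succ t =>
    have hs : ∀ t, StronglyMeasurable (Y t) := fun t => (hY t).stronglyMeasurable
    rw [IndepFun_iff_Indep]
    exact (indep_of_indep_of_le_right
      (hind.indep_comap_natural_of_lt hs (Nat.lt_succ_self t))
      (measurable_lindley_natural hs t).comap_le).symm

theorem integrable_comp_lindley (hY : ∀ t, Measurable (Y t))
    (hD : ∀ t, ∀ᵐ ω ∂P, |Y t ω| ≤ D) (t : ℕ) {g : ℝ × ℝ → ℝ} (hg : Continuous g) :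
    Integrable (fun ω => g (lindley Y t ω, Y t ω)) P := by
  have hK : IsCompact (Set.Icc (0 : ℝ) (t * D) ×ˢ Set.Icc (-D) D) :=
    isCompact_Icc.prod isCompact_Icc
  obtain ⟨C, hC⟩ := hK.exists_bound_of_continuousOn hg.continuousOn
  refine Integrable.of_bound
    (hg.measurable.comp ((measurable_lindley hY t).prodMk (hY t))).aestronglyMeasurable C ?_
  filter_upwards [lindley_ae_le hD t, hD t] with ω h1 h2
  exact hC _ ⟨⟨lindley_nonneg Y t ω, h1⟩, abs_le.1 h2⟩

/-- With negative drift, Lindley's recursion has bounded second moments. -/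
theorem exists_lindley_sq_le (hY : ∀ t, Measurable (Y t)) (hind : iIndepFun Y P)
    (hD0 : 0 < D) (hD : ∀ t, ∀ᵐ ω ∂P, |Y t ω| ≤ D) (hε : 0 < ε)
    (hmean : ∀ t, ∫ ω, Y t ω ∂P = -ε) :
    ∃ C : ℝ, 0 < C ∧ ∀ t, ∫ ω, lindley Y t ω ^ 2 ∂P ≤ C := by
  -- So small that the quadratic remainder of exp(θY) is at most half of the linear drift θε.
  obtain ⟨θ, hθ0, hθD, hθε⟩ : ∃ θ : ℝ, 0 < θ ∧ θ * D ≤ 1 ∧ θ * D ^ 2 ≤ ε / 2 := by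
    refine ⟨min (1 / D) (ε / 2 / D ^ 2), by positivity, ?_, ?_⟩
    · rw [← le_div_iff₀ hD0]; exact min_le_left _ _
    · rw [← le_div_iff₀ (by positivity)]; exact min_le_right _ _
  have hexpY : ∀ t, ∫ ω, Real.exp (θ * Y t ω) ∂P ≤ 1 - θ * ε / 2 := by
    intro t
    have hpt : ∀ᵐ ω ∂P, Real.exp (θ * Y t ω) ≤ θ * Y t ω + (1 + θ * (ε / 2)) := by
      filter_upwards [hD t] with ω h
      have h1 : |θ * Y t ω| ≤ θ * D := by
        rw [abs_mul, abs_of_pos hθ0]; gcongr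
      have h2 := le_of_abs_le (Real.abs_exp_sub_one_sub_id_le (h1.trans hθD))
      have h3 : (θ * Y t ω) ^ 2 ≤ (θ * D) ^ 2 := sq_le_sq' (abs_le.1 h1).1 (abs_le.1 h1).2
      have h4 : θ * (θ * D ^ 2) ≤ θ * (ε / 2) := by gcongr
      nlinarith
    have hi1 : Integrable (fun ω => Real.exp (θ * Y t ω)) P :=
      integrable_comp_lindley hY hD t (g := fun p => Real.exp (θ * p.2)) (by fun_prop)
    have hi2 : Integrable (fun ω => θ * Y t ω) P :=
      integrable_comp_lindley hY hD t (g := fun p => θ * p.2) (by fun_prop)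
    refine (integral_mono_ae hi1 (hi2.add (integrable_const _)) hpt).trans ?_
    simp only [Pi.add_apply]
    rw [integral_add hi2 (integrable_const _), integral_const_mul, hmean, integral_const,
      probReal_univ, one_smul]
    linarith
  -- The recursion E' ≤ (1 - θε/2)E + 1 has fixed point 2 / (θε); the extra 1 covers the initial
  -- value. The summand 1 in the recursion comes from exp(θ max(z, 0)) ≤ exp(θz) + 1.
  have hexp : ∀ t, ∫ ω, Real.exp (θ * lindley Y t ω) ∂P ≤ 1 + 2 / (θ * ε) := by
    intro t
    induction t with
    | zero =>
      simp only [lindley, mul_zero, Real.exp_zero, integral_const, probReal_univ, one_smul]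
      linarith [show 0 < 2 / (θ * ε) by positivity]
    | succ t ih =>
      have hpt : ∀ ω, Real.exp (θ * lindley Y (t + 1) ω) ≤
          Real.exp (θ * lindley Y t ω) * Real.exp (θ * Y t ω) + 1 := by
        intro ω
        rw [← Real.exp_add, ← mul_add]
        simp only [lindley]
        rcases le_total (lindley Y t ω + Y t ω) 0 with h | h
        · rw [max_eq_right h, mul_zero, Real.exp_zero]
          linarith [Real.exp_pos (θ * (lindley Y t ω + Y t ω))]
        · rw [max_eq_left h]
          linarith
      have hi1 : Integrable (fun ω => Real.exp (θ * lindley Y (t + 1) ω)) P :=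
        integrable_comp_lindley hY hD (t + 1) (g := fun p => Real.exp (θ * p.1)) (by fun_prop)
      have hi2 : Integrable
          (fun ω => Real.exp (θ * lindley Y t ω) * Real.exp (θ * Y t ω)) P :=
        integrable_comp_lindley hY hD t
          (g := fun p => Real.exp (θ * p.1) * Real.exp (θ * p.2)) (by fun_prop)
      refine (integral_mono hi1 (hi2.add (integrable_const _)) hpt).trans ?_
      simp only [Pi.add_apply]
      rw [integral_add hi2 (integrable_const _), integral_const, probReal_univ, one_smul]
      have hm : Measurable fun y : ℝ => Real.exp (θ * y) := by fun_prop
      have hprod := ((indepFun_lindley hY hind t).comp hm hm).integral_fun_mul_eq_mul_integral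
        (hm.comp (measurable_lindley hY t)).aestronglyMeasurable
        (hm.comp (hY t)).aestronglyMeasurable
      simp only [Function.comp_apply] at hprod
      rw [hprod]
      have h0 : 0 ≤ ∫ ω, Real.exp (θ * Y t ω) ∂P :=
        integral_nonneg fun ω => (Real.exp_pos _).le
      have h1 := mul_le_mul_of_nonneg_right ih h0
      have h2 := mul_le_mul_of_nonneg_left (hexpY t)
        (show 0 ≤ 1 + 2 / (θ * ε) by positivity)
      have h3 : (1 + 2 / (θ * ε)) * (1 - θ * ε / 2) = 2 / (θ * ε) - θ * ε / 2 := by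
        field_simp; ring
      have h4 : 0 < θ * ε := by positivity
      linarith
  refine ⟨2 / θ ^ 2 * (1 + 2 / (θ * ε)), by positivity, fun t => ?_⟩
  have hpt : ∀ ω, lindley Y t ω ^ 2 ≤ 2 / θ ^ 2 * Real.exp (θ * lindley Y t ω) := by
    intro ω
    have h0 := mul_nonneg hθ0.le (lindley_nonneg Y t ω)
    have h1 := Real.quadratic_le_exp_of_nonneg h0
    have h2 : 2 / θ ^ 2 * ((θ * lindley Y t ω) ^ 2 / 2) ≤
        2 / θ ^ 2 * Real.exp (θ * lindley Y t ω) := by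
      gcongr
      linarith
    refine le_trans (le_of_eq ?_) h2
    field_simp
  have hi1 : Integrable (fun ω => lindley Y t ω ^ 2) P :=
    integrable_comp_lindley hY hD t (g := fun p => p.1 ^ 2) (by fun_prop)
  have hi2 : Integrable (fun ω => Real.exp (θ * lindley Y t ω)) P :=
    integrable_comp_lindley hY hD t (g := fun p => Real.exp (θ * p.1)) (by fun_prop)
  refine (integral_mono hi1 (hi2.const_mul _) hpt).trans ?_
  rw [integral_const_mul]
  exact mul_le_mul_of_nonneg_left (hexp t) (by positivity)

/-- Kingman's lower bound for the eventual mean of Lindley's recursion. -/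
theorem le_of_eventually_lindley_le (hY : ∀ t, Measurable (Y t)) (hind : iIndepFun Y P)
    (hD0 : 0 < D) (hD : ∀ t, ∀ᵐ ω ∂P, |Y t ω| ≤ D) (hε : 0 < ε)
    (hmean : ∀ t, ∫ ω, Y t ω ∂P = -ε) {S : ℝ} (hsq : ∀ t, ∫ ω, Y t ω ^ 2 ∂P = S)
    (hb0 : 0 ≤ b) (hb : ∀ t ω, -b ≤ Y t ω) {m : ℝ}
    (hm : ∀ᶠ t in atTop, ∫ ω, lindley Y t ω ∂P ≤ m) : S - b * ε ≤ 2 * ε * m := by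
  obtain ⟨C, hC0, hC⟩ := exists_lindley_sq_le hY hind hD0 hD hε hmean
  have hi : ∀ t, Integrable (lindley Y t) P := fun t =>
    integrable_comp_lindley hY hD t (g := fun p => p.1) (by fun_prop)
  have hi2 : ∀ t, Integrable (fun ω => lindley Y t ω ^ 2) P := fun t =>
    integrable_comp_lindley hY hD t (g := fun p => p.1 ^ 2) (by fun_prop)
  have hstep : ∀ t, (∫ ω, lindley Y t ω ^ 2 ∂P + b * ∫ ω, lindley Y t ω ∂P) +
      (S - b * ε - 2 * ε * ∫ ω, lindley Y t ω ∂P) ≤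
      ∫ ω, lindley Y (t + 1) ω ^ 2 ∂P + b * ∫ ω, lindley Y (t + 1) ω ∂P := by
    intro t
    -- The left side is z² + bz for z = W + Y, where W is the recursion. If reflection occurs then
    -- -b ≤ z ≤ 0, so z² + bz ≤ 0 and reflection only helps.
    have hpt : ∀ ω, lindley Y t ω ^ 2 + b * lindley Y t ω + 2 * (lindley Y t ω * Y t ω) +
        Y t ω ^ 2 + b * Y t ω ≤ lindley Y (t + 1) ω ^ 2 + b * lindley Y (t + 1) ω := by
      intro ω
      have h1 := hb t ω
      have h0 := lindley_nonneg Y t ω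
      simp only [lindley]
      rcases le_total (lindley Y t ω + Y t ω) 0 with h | h
      · rw [max_eq_right h]
        nlinarith
      · rw [max_eq_left h]
        linarith
    have hi3 : Integrable (fun ω => 2 * (lindley Y t ω * Y t ω)) P :=
      integrable_comp_lindley hY hD t (g := fun p => 2 * (p.1 * p.2)) (by fun_prop)
    have hi4 : Integrable (fun ω => Y t ω ^ 2) P :=
      integrable_comp_lindley hY hD t (g := fun p => p.2 ^ 2) (by fun_prop)
    have hi5 : Integrable (fun ω => b * Y t ω) P :=
      integrable_comp_lindley hY hD t (g := fun p => b * p.2) (by fun_prop)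
    have hi6 : Integrable (fun ω => lindley Y t ω ^ 2 + b * lindley Y t ω) P :=
      (hi2 t).add ((hi t).const_mul b)
    have hi7 : Integrable (fun ω => lindley Y t ω ^ 2 + b * lindley Y t ω +
      2 * (lindley Y t ω * Y t ω)) P := hi6.add hi3
    have hi8 : Integrable (fun ω => lindley Y t ω ^ 2 + b * lindley Y t ω +
      2 * (lindley Y t ω * Y t ω) + Y t ω ^ 2) P := hi7.add hi4
    have h := integral_mono (hi8.add hi5) ((hi2 (t + 1)).add ((hi (t + 1)).const_mul b)) hpt
    simp only [Pi.add_apply] at h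
    rw [integral_add hi8 hi5, integral_add hi7 hi4, integral_add hi6 hi3,
      integral_add (hi2 t) ((hi t).const_mul b),
      integral_add (hi2 (t + 1)) ((hi (t + 1)).const_mul b)] at h
    have hprod := (indepFun_lindley hY hind t).integral_fun_mul_eq_mul_integral
      (measurable_lindley hY t).aestronglyMeasurable (hY t).aestronglyMeasurable
    simp only [integral_const_mul] at h
    rw [hprod, hmean, hsq] at h
    linarith
  obtain ⟨T, hT⟩ := eventually_atTop.1 hm
  set W : ℕ → ℝ := fun t => ∫ ω, lindley Y t ω ^ 2 ∂P + b * ∫ ω, lindley Y t ω ∂P with hW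
  have hWle : ∀ t, W t ≤ C + b * (C + 1) := by
    intro t
    have h1 : ∫ ω, lindley Y t ω ∂P ≤ ∫ ω, (lindley Y t ω ^ 2 + 1) ∂P :=
      integral_mono (hi t) ((hi2 t).add (integrable_const _)) fun ω => by
        nlinarith [sq_nonneg (lindley Y t ω - 1)]
    rw [integral_add (hi2 t) (integrable_const _), integral_const, probReal_univ,
      one_smul] at h1
    have h2 := mul_le_mul_of_nonneg_left (h1.trans (add_le_add_left (hC t) 1)) hb0
    exact add_le_add (hC t) h2
  -- Were the claimed inequality false, this bounded functional would grow linearly.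
  have hgrow : ∀ n : ℕ, W T + n * (S - b * ε - 2 * ε * m) ≤ W (T + n) := by
    intro n
    induction n with
    | zero => simp
    | succ n ih =>
      have h1 := hstep (T + n)
      have h2 := mul_le_mul_of_nonneg_left (hT (T + n) (Nat.le_add_right _ _))
        (show 0 ≤ 2 * ε by positivity)
      rw [← add_assoc]
      push_cast
      simp only [hW] at ih ⊢
      linarith
  by_contra! hcon
  obtain ⟨n, hn⟩ := exists_nat_gt ((C + b * (C + 1) - W T) / (S - b * ε - 2 * ε * m))
  rw [div_lt_iff₀ (by linarith)] at hn
  linarith [hgrow n, hWle (T + n)]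

end Lindley

/-! ### Transfer to feasible policies and their limits in distribution -/

section Feasible

variable {𝒮 : Finset (Fin L → ℕ)} {α : Fin L → PMF ℕ} {Amax : ℕ}
  {c : EuclideanSpace ℝ (Fin L)} {b : ℝ}

/-- Each slot removes at most b of workload, so domination is inductive and pathwise; it needs no
assumption on how schedules are chosen. -/
theorem lindley_le_inner {Ω : Type*} (hc : ∀ l, 0 ≤ c l)
    (hb : ∀ s ∈ 𝒮, (inner ℝ c (toVec s) : ℝ) ≤ b) {A S Q : ℕ → Ω → Fin L → ℕ}
    (hS : ∀ t ω, S t ω ∈ 𝒮)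
    (hQ : ∀ t ω l, Q (t + 1) ω l = Q t ω l + A t ω l - S t ω l) (t : ℕ) (ω : Ω) :
    lindley (fun t ω => (inner ℝ c (toVec (A t ω)) : ℝ) - b) t ω ≤
      inner ℝ c (toVec (Q t ω)) := by
  induction t with
  | zero => exact inner_toVec_nonneg hc _
  | succ t ih =>
    have hq : Q (t + 1) ω = Q t ω + A t ω - S t ω := funext fun l => hQ t ω l
    refine max_le ?_ (inner_toVec_nonneg hc _)
    rw [hq, inner_next c b]
    linarith [hb _ (hS t ω), inner_toVec_nonneg hc (S t ω - (Q t ω + A t ω))]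

/-- A bounded second moment makes the mean upper semicontinuous along convergence in
distribution. -/
theorem eventually_integral_le {Ω : Type*} {mΩ : MeasurableSpace Ω} {P : Measure Ω}
    [IsProbabilityMeasure P] {Q : ℕ → Ω → Fin L → ℕ} (hQm : ∀ t, Measurable (Q t))
    {π : PMF (Fin L → ℕ)} (hlim : ∀ q, Tendsto (fun t => P (Q t ⁻¹' {q})) atTop (𝓝 (π q)))
    {x : (Fin L → ℕ) → ℝ} (hx : ∀ q, 0 ≤ x q) {φ : ℕ → Ω → ℝ} (hφi : ∀ t, Integrable (φ t) P)
    (hφi2 : ∀ t, Integrable (fun ω => φ t ω ^ 2) P) (hφ : ∀ t ω, φ t ω ≤ x (Q t ω))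
    {C : ℝ} (hC0 : 0 < C) (hC : ∀ t, ∫ ω, φ t ω ^ 2 ∂P ≤ C)
    (hfin : ∑' q, π q * ENNReal.ofReal (x q) ≠ ⊤) {η : ℝ} (hη : 0 < η) :
    ∀ᶠ t in atTop, ∫ ω, φ t ω ∂P ≤ (∑' q, π q * ENNReal.ofReal (x q)).toReal + η := by
  classical
  set m := (∑' q, π q * ENNReal.ofReal (x q)).toReal with hm
  set k := η / 3 / C with hk
  have hk0 : 0 < k := by positivity
  have hsum : HasSum (fun q => (π q).toReal) 1 := by
    have := ENNReal.hasSum_toReal (f := π) (by simp [π.tsum_coe])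
    rwa [← ENNReal.tsum_toReal_eq fun q => π.apply_ne_top q, π.tsum_coe,
      ENNReal.toReal_one] at this
  obtain ⟨F, hF⟩ := (hsum.eventually_const_lt
    (show 1 - 4 * k * (η / 3) < 1 by linarith [show 0 < 4 * k * (η / 3) by positivity])).exists
  have hFm : ∑ q ∈ F, (π q).toReal * x q ≤ m := by
    have h1 := ENNReal.toReal_mono hfin (ENNReal.sum_le_tsum F)
    rw [ENNReal.toReal_sum fun q _ =>
      ENNReal.mul_ne_top (π.apply_ne_top q) ENNReal.ofReal_ne_top] at h1
    refine le_trans (le_of_eq (Finset.sum_congr rfl fun q _ => ?_)) h1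
    rw [ENNReal.toReal_mul, ENNReal.toReal_ofReal (hx q)]
  have hbound : ∀ t, ∫ ω, φ t ω ∂P ≤
      ∑ q ∈ F, (P (Q t ⁻¹' {q})).toReal * (x q - 1 / (4 * k)) + (k * C + 1 / (4 * k)) := by
    intro t
    have hmeas : ∀ q, MeasurableSet (Q t ⁻¹' {q}) := fun q =>
      hQm t (measurableSet_singleton q)
    -- On F the bound x is used; off F, Young's inequality φ ≤ kφ² + 1/(4k).
    have hpt : ∀ ω, φ t ω ≤ ∑ q ∈ F, (Q t ⁻¹' {q}).indicator (fun _ => x q - 1 / (4 * k)) ω +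
        (k * φ t ω ^ 2 + 1 / (4 * k)) := by
      intro ω
      have hid : ∀ q, (Q t ⁻¹' {q}).indicator (fun _ => x q - 1 / (4 * k)) ω =
          if Q t ω = q then x q - 1 / (4 * k) else 0 := fun q => by
        simp [Set.indicator_apply]
      simp only [hid, Finset.sum_ite_eq]
      have hk4 : k * φ t ω ^ 2 + 1 / (4 * k) - φ t ω = k * (φ t ω - 1 / (2 * k)) ^ 2 := by
        field_simp; ring
      have hk5 : 0 ≤ k * (φ t ω - 1 / (2 * k)) ^ 2 := by positivity
      split_ifs
      · have : 0 ≤ k * φ t ω ^ 2 := by positivity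
        linarith [hφ t ω]
      · linarith
    have hi1 : ∀ q ∈ F, Integrable ((Q t ⁻¹' {q}).indicator fun _ => x q - 1 / (4 * k)) P :=
      fun q _ => (integrable_const _).indicator (hmeas q)
    have hi2 : Integrable
        (fun ω => ∑ q ∈ F, (Q t ⁻¹' {q}).indicator (fun _ => x q - 1 / (4 * k)) ω) P :=
      integrable_finsetSum F hi1
    have hi3 : Integrable (fun ω => k * φ t ω ^ 2) P := (hφi2 t).const_mul k
    have hi4 : Integrable (fun ω => k * φ t ω ^ 2 + 1 / (4 * k)) P :=
      hi3.add (integrable_const _)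
    refine (integral_mono (hφi t) (hi2.add hi4) hpt).trans ?_
    simp only [Pi.add_apply]
    rw [integral_add hi2 hi4, integral_finsetSum F hi1, integral_add hi3 (integrable_const _),
      integral_const_mul, integral_const, probReal_univ, one_smul]
    refine add_le_add (le_of_eq (Finset.sum_congr rfl fun q _ => ?_))
      (add_le_add_left (mul_le_mul_of_nonneg_left (hC t) hk0.le) _)
    rw [integral_indicator (hmeas q), setIntegral_const, smul_eq_mul]
    rfl
  have htend : Tendsto (fun t => ∑ q ∈ F, (P (Q t ⁻¹' {q})).toReal * (x q - 1 / (4 * k)) +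
      (k * C + 1 / (4 * k))) atTop
      (𝓝 (∑ q ∈ F, (π q).toReal * (x q - 1 / (4 * k)) + (k * C + 1 / (4 * k)))) :=
    (tendsto_finsetSum F fun q _ => ((ENNReal.tendsto_toReal (π.apply_ne_top q)).comp
      (hlim q)).mul_const _).add_const _
  have hlt : ∑ q ∈ F, (π q).toReal * (x q - 1 / (4 * k)) + (k * C + 1 / (4 * k)) < m + η := by
    simp only [mul_sub, Finset.sum_sub_distrib, ← Finset.sum_mul]
    have h1 : k * C = η / 3 := by rw [hk]; field_simp
    have h2 : (1 - ∑ q ∈ F, (π q).toReal) * (1 / (4 * k)) ≤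
        4 * k * (η / 3) * (1 / (4 * k)) := by
      gcongr
      linarith
    have h3 : 4 * k * (η / 3) * (1 / (4 * k)) = η / 3 := by field_simp
    linarith
  filter_upwards [htend.eventually_lt_const hlt] with t ht
  exact (hbound t).trans ht.le

/-- The universal lower bound for the first moment, for every feasible policy. -/
theorem IsFeasibleSteadyState.zeta_le (hα : BoundedArrivals α Amax) {π : PMF (Fin L → ℕ)}
    (hπ : IsFeasibleSteadyState 𝒮 α π) (hc : ∀ l, 0 ≤ c l) (hb0 : 0 ≤ b)
    (hb : ∀ s ∈ 𝒮, (inner ℝ c (toVec s) : ℝ) ≤ b)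
    {ε : ℝ} (hε0 : 0 < ε) (hε : ε = b - inner ℝ c (rate α)) :
    ENNReal.ofReal (zeta c (arrivalVar α)) ≤
      ENNReal.ofReal (2 * ε) * meanWorkload c π + ENNReal.ofReal (b * ε) := by
  obtain ⟨Ω, _, P, _, A, S, Q, hA, -, hQm, hind, hlaw, hS, hQ, hlim⟩ := hπ
  -- An infinite mean makes the bound trivial, since ε > 0.
  rcases eq_or_ne (meanWorkload c π) ⊤ with htop | htop
  · rw [htop, ENNReal.mul_top (by simpa using hε0), top_add]
    exact le_top
  set y : (Fin L → ℕ) → ℝ := fun a => (inner ℝ c (toVec a) : ℝ) - b with hy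
  have hym : Measurable y := measurable_of_countable y
  set Y : ℕ → Ω → ℝ := fun t ω => y (A t ω) with hYdef
  have hY : ∀ t, Measurable (Y t) := fun t => hym.comp (hA t)
  have hindY : iIndepFun Y P := hind.comp (fun _ => y) fun _ => hym
  have hmap : ∀ (g : (Fin L → ℕ) → ℝ) t, ∫ ω, g (A t ω) ∂P = ∫ a, g a ∂arrivalMeasure α := by
    intro g t
    rw [← toMeasure_arrivalLaw, ← hlaw t, integral_map (hA t).aemeasurable
      (measurable_of_countable g).aestronglyMeasurable]
  obtain ⟨D, hD0, hD⟩ : ∃ D > 0, ∀ t, ∀ᵐ ω ∂P, |Y t ω| ≤ D := by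
    refine ⟨1 + ∑ a ∈ Fintype.piFinset fun _ : Fin L => Finset.range (Amax + 1), |y a|,
      add_pos_of_pos_of_nonneg one_pos (Finset.sum_nonneg fun _ _ => abs_nonneg _),
      fun t => ?_⟩
    have h1 := ae_le_of_bounded hα
    rw [← toMeasure_arrivalLaw, ← hlaw t] at h1
    filter_upwards [ae_of_ae_map (hA t).aemeasurable h1] with ω h
    have h2 := Finset.single_le_sum (f := fun a => |y a|) (fun _ _ => abs_nonneg _)
      (show A t ω ∈ Fintype.piFinset fun _ : Fin L => Finset.range (Amax + 1) by
        simpa [Fintype.mem_piFinset, Nat.lt_succ_iff] using h)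
    exact h2.trans (le_add_of_nonneg_left zero_le_one)
  have hmean : ∀ t, ∫ ω, Y t ω ∂P = -ε := by
    intro t
    refine (hmap y t).trans ?_
    rw [integral_sub (integrable_arrival hα _) (integrable_const _), integral_inner hα,
      integral_const, probReal_univ, one_smul, hε]
    ring
  have hsq : ∀ t, ∫ ω, Y t ω ^ 2 ∂P = zeta c (arrivalVar α) + ε ^ 2 := by
    intro t
    refine (hmap (fun a => y a ^ 2) t).trans ?_
    rw [integral_sq hα, hε]
    ring
  have hb' : ∀ t ω, -b ≤ Y t ω := fun t ω => by
    simp only [hYdef, hy]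
    linarith [inner_toVec_nonneg hc (A t ω)]
  obtain ⟨C, hC0, hC⟩ := exists_lindley_sq_le hY hindY hD0 hD hε0 hmean
  have hfin : ∑' q, π q * ENNReal.ofReal (inner ℝ c (toVec q)) ≠ ⊤ := by
    rwa [← meanWorkload_eq_tsum]
  have hreal : zeta c (arrivalVar α) ≤ 2 * ε * (meanWorkload c π).toReal + b * ε := by
    refine le_of_forall_pos_le_add fun η hη => ?_
    have hev := eventually_integral_le (φ := lindley Y) hQm hlim
      (x := fun q => inner ℝ c (toVec q)) (fun q => inner_toVec_nonneg hc q)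
      (fun t => integrable_comp_lindley hY hD t (g := fun p => p.1) (by fun_prop))
      (fun t => integrable_comp_lindley hY hD t (g := fun p => p.1 ^ 2) (by fun_prop))
      (fun t ω => lindley_le_inner hc hb hS hQ t ω) hC0 hC hfin
      (show 0 < η / (2 * ε) by positivity)
    have h := le_of_eventually_lindley_le hY hindY hD0 hD hε0 hmean hsq hb0 hb' hev
    rw [← meanWorkload_eq_tsum, mul_add, mul_div_cancel₀ _ (by positivity)] at h
    linarith [sq_nonneg ε]
  rw [← ENNReal.ofReal_toReal htop, ← ENNReal.ofReal_mul (by positivity),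
    ← ENNReal.ofReal_add (by positivity) (by positivity)]
  exact ENNReal.ofReal_le_ofReal hreal

end Feasible

end MaxWeight

namespace MaxWeight

variable {L K : ℕ}

/-! ## Heavy traffic -/

section HeavyTraffic

variable {𝒮 : Finset (Fin L → ℕ)} {c : Fin K → EuclideanSpace ℝ (Fin L)} {b : Fin K → ℝ}

theorem momentBound_nonneg {D d : ℝ} (hD : 0 ≤ D) (hd : 0 < d) : 0 ≤ momentBound D d := by
  unfold momentBound
  positivity

/-- For arrival rates that project into a compact part of the relative interior of a face, the
first moment bound holds with constants that do not depend on the arrivals. -/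
theorem IsMinimalDescription.exists_mul_meanWorkload_le (hd : IsMinimalDescription 𝒮 c b)
    (h𝒮 : 𝒮.Nonempty) (Amax : ℕ) (k : Fin K) {C : Set (EuclideanSpace ℝ (Fin L))}
    (hC : IsCompact C) (hCF : C ⊆ intrinsicInterior ℝ (face 𝒮 (c k) (b k))) :
    ∃ E₁ E₂ : ℝ, 0 ≤ E₁ ∧ 0 ≤ E₂ ∧ ∀ α : Fin L → PMF ℕ, BoundedArrivals α Amax →
      rate α ∈ interior (capacityRegion 𝒮) → projection α (c k) (b k) ∈ C →
      ∀ π, IsMaxWeightSteadyState 𝒮 h𝒮 α π →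
        ENNReal.ofReal (2 * gap α (c k) (b k)) * meanWorkload (c k) π ≤
          ENNReal.ofReal (zeta (c k) (arrivalVar α) + (gap α (c k) (b k) ^ 2 +
            E₁ * gap α (c k) (b k) + E₂ * √(gap α (c k) (b k)))) := by
  obtain ⟨D, hD0, hD⟩ := exists_isSizeBound 𝒮 Amax
  obtain ⟨δ, hδ, hball⟩ := hd.exists_uniform_radius k hC hCF
  obtain ⟨G, hG0, hG, hG'⟩ := exists_deficit_bound 𝒮 (c k) (b k)
  -- Half of δ, since the drift estimate wants a closed ball and δ is the radius of an open one.
  have hN := momentBound_nonneg hD0 (half_pos hδ)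
  refine ⟨2 * D, D * G + 2 * D ^ 2 * G + 36 * D ^ 2 + 6 * momentBound D (δ / 2), by positivity,
    by positivity, fun α hα hrate hproj π hπ => ?_⟩
  have hb : ∀ s ∈ 𝒮, (inner ℝ (c k) (toVec s) : ℝ) ≤ b k := fun s hs =>
    hd.inner_le k (toVec_mem_capacityRegion hs)
  have hface : projection α (c k) (b k) ∈ face 𝒮 (c k) (b k) :=
    intrinsicInterior_subset (hCF hproj)
  have hcc : (inner ℝ (c k) (c k) : ℝ) • c k = c k := by rw [hd.inner_self, one_smul]
  exact mul_meanWorkload_le hα hπ.bind_eq hD0 hD (hd.norm_eq_one k) (hd.nonneg k)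
    (hd.offset_pos k).le hb hG0 hG hG' hface.2 hface.1 (hd.gap_pos k hrate) (hd.gap_eq k hrate)
    hN (perp_second_moment_le hα hπ.bind_eq hD0 hD hcc (hd.nonneg k) (half_pos hδ)
      (r := projection α (c k) (b k)) rfl
      (fun v hv hvδ => (hball _ hproj v hv (by linarith)).2)
      fun s hs => (hb s hs).trans_eq (Eq.symm hface.1))

theorem tendsto_zeta (c : EuclideanSpace ℝ (Fin L)) {α : ℕ → Fin L → PMF ℕ} {v : Fin L → ℝ}
    (hv : ∀ l, Tendsto (fun n => arrivalVar (α n) l) atTop (𝓝 (v l))) :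
    Tendsto (fun n => zeta c (arrivalVar (α n))) atTop (𝓝 (zeta c v)) :=
  tendsto_finsetSum _ fun l _ => (hv l).const_mul _

theorem ofReal_mul_eq_half {ε : ℝ} (m : ℝ≥0∞) :
    ENNReal.ofReal ε * m = ENNReal.ofReal (1 / 2) * (ENNReal.ofReal (2 * ε) * m) := by
  rw [← mul_assoc, ← ENNReal.ofReal_mul (by norm_num)]
  congr 2
  ring

theorem half_zeta_le {ζ ε b : ℝ} {m : ℝ≥0∞} (hε : 0 ≤ ε) (hb : 0 ≤ b)
    (h : ENNReal.ofReal ζ ≤ ENNReal.ofReal (2 * ε) * m + ENNReal.ofReal (b * ε)) :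
    ENNReal.ofReal (ζ / 2 - b * ε / 2) ≤ ENNReal.ofReal ε * m := by
  have h1 : ENNReal.ofReal (ζ - b * ε) ≤ ENNReal.ofReal (2 * ε) * m := by
    rw [ENNReal.ofReal_sub _ (by positivity)]
    exact tsub_le_iff_right.2 h
  rw [ofReal_mul_eq_half, show ζ / 2 - b * ε / 2 = 1 / 2 * (ζ - b * ε) by ring,
    ENNReal.ofReal_mul (by norm_num)]
  gcongr

theorem tendsto_lower {c : EuclideanSpace ℝ (Fin L)} {α : ℕ → Fin L → PMF ℕ} {v : Fin L → ℝ}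
    (hv : ∀ l, Tendsto (fun n => arrivalVar (α n) l) atTop (𝓝 (v l))) {e : ℕ → ℝ}
    (he : Tendsto e atTop (𝓝 0)) (b : ℝ) :
    Tendsto (fun n => ENNReal.ofReal (zeta c (arrivalVar (α n)) / 2 - b * e n / 2)) atTop
      (𝓝 (ENNReal.ofReal (zeta c v / 2))) := by
  refine ENNReal.tendsto_ofReal ?_
  have h := ((tendsto_zeta c hv).div_const 2).sub ((he.const_mul b).div_const 2)
  simpa using h

theorem tendsto_upper {c : EuclideanSpace ℝ (Fin L)} {α : ℕ → Fin L → PMF ℕ} {v : Fin L → ℝ}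
    (hv : ∀ l, Tendsto (fun n => arrivalVar (α n) l) atTop (𝓝 (v l))) {e : ℕ → ℝ}
    (he : Tendsto e atTop (𝓝 0)) (E₁ E₂ : ℝ) :
    Tendsto (fun n => ENNReal.ofReal (1 / 2) * ENNReal.ofReal (zeta c (arrivalVar (α n)) +
      (e n ^ 2 + E₁ * e n + E₂ * √(e n)))) atTop (𝓝 (ENNReal.ofReal (zeta c v / 2))) := by
  have hs : Tendsto (fun n => √(e n)) atTop (𝓝 0) := by
    have h := (Real.continuous_sqrt.tendsto 0).comp he
    rwa [Real.sqrt_zero] at h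
  have h := ((tendsto_zeta c hv).add (((he.pow 2).add (he.const_mul E₁)).add
    (hs.const_mul E₂))).const_mul (1 / 2)
  simp_rw [← ENNReal.ofReal_mul (show (0 : ℝ) ≤ 1 / 2 by norm_num)]
  refine ENNReal.tendsto_ofReal ?_
  convert h using 2
  ring

/-- The remainder of the first moment bound. -/
theorem exists_remainder {E₁ E₂ : ℝ} (h₁ : 0 ≤ E₁) (h₂ : 0 ≤ E₂) :
    ∃ B : ℝ → ℝ≥0, Tendsto (fun e => e * (B e : ℝ)) (𝓝[>] 0) (𝓝 0) ∧
      ∀ e, 0 < e → (B e : ℝ) = (e ^ 2 + E₁ * e + E₂ * √e) / (2 * e) := by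
  have hB : ∀ e : ℝ, 0 < e → (((e ^ 2 + E₁ * e + E₂ * √e) / (2 * e)).toNNReal : ℝ) =
      (e ^ 2 + E₁ * e + E₂ * √e) / (2 * e) := fun e he =>
    Real.coe_toNNReal _ (by positivity)
  refine ⟨fun e => ((e ^ 2 + E₁ * e + E₂ * √e) / (2 * e)).toNNReal, ?_, hB⟩
  have h : Tendsto (fun e : ℝ => (e ^ 2 + E₁ * e + E₂ * √e) / 2) (𝓝[>] 0) (𝓝 0) := by
    have hc : Continuous fun e : ℝ => (e ^ 2 + E₁ * e + E₂ * √e) / 2 := by fun_prop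
    simpa using (hc.tendsto 0).mono_left nhdsWithin_le_nhds
  refine h.congr' ?_
  filter_upwards [self_mem_nhdsWithin] with e he
  have he : 0 < e := he
  rw [hB e he]
  field_simp

end HeavyTraffic

end MaxWeight

/-! ### The main theorem -/

theorem mainTheorem1 {L K : ℕ} (𝒮 : Finset (Fin L → ℕ))
    (h0 : (0 : Fin L → ℕ) ∈ 𝒮)
    (c : Fin K → EuclideanSpace ℝ (Fin L)) (b : Fin K → ℝ)
    (hdesc : IsMinimalDescription 𝒮 c b) (Amax : ℕ) :
    -- a steady state exists under MaxWeight for all arrival rates in the interior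
    (∀ α : Fin L → PMF ℕ, BoundedArrivals α Amax → rate α ∈ interior (capacityRegion 𝒮) →
      ∃ π, IsMaxWeightSteadyState 𝒮 ⟨0, h0⟩ α π) ∧
    ∀ (k : Fin K) (C : Set (EuclideanSpace ℝ (Fin L))), IsCompact C →
      C ⊆ intrinsicInterior ℝ (face 𝒮 (c k) (b k)) →
      -- the bound on the first moment
      (∃ B : ℝ → ℝ≥0, Tendsto (fun e => e * (B e : ℝ)) (𝓝[>] 0) (𝓝 0) ∧
        ∀ α : Fin L → PMF ℕ, BoundedArrivals α Amax →
          rate α ∈ interior (capacityRegion 𝒮) → projection α (c k) (b k) ∈ C →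
          ∀ π, IsMaxWeightSteadyState 𝒮 ⟨0, h0⟩ α π →
            meanWorkload (c k) π ≤ ENNReal.ofReal
              (zeta (c k) (arrivalVar α) / (2 * gap α (c k) (b k)) + B (gap α (c k) (b k)))) ∧
      -- heavy traffic
      ∀ (α : ℕ → Fin L → PMF ℕ) (v : Fin L → ℝ),
        (∀ n, BoundedArrivals (α n) Amax) →
        (∀ n, rate (α n) ∈ interior (capacityRegion 𝒮)) →
        (∀ n, projection (α n) (c k) (b k) ∈ C) →
        Tendsto (fun n => gap (α n) (c k) (b k)) atTop (𝓝 0) →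
        (∀ l, Tendsto (fun n => arrivalVar (α n) l) atTop (𝓝 (v l))) →
        -- the upper limit under MaxWeight, which is in fact a limit
        (∀ π : ℕ → PMF (Fin L → ℕ), (∀ n, IsMaxWeightSteadyState 𝒮 ⟨0, h0⟩ (α n) (π n)) →
          limsup (fun n => ENNReal.ofReal (gap (α n) (c k) (b k)) * meanWorkload (c k) (π n))
              atTop ≤ ENNReal.ofReal (zeta (c k) v / 2) ∧
          Tendsto (fun n => ENNReal.ofReal (gap (α n) (c k) (b k)) * meanWorkload (c k) (π n))
              atTop (𝓝 (ENNReal.ofReal (zeta (c k) v / 2)))) ∧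
        -- optimality: no feasible policy does better
        (∀ π : ℕ → PMF (Fin L → ℕ), (∀ n, IsFeasibleSteadyState 𝒮 (α n) (π n)) →
          ENNReal.ofReal (zeta (c k) v / 2) ≤
            liminf (fun n => ENNReal.ofReal (gap (α n) (c k) (b k)) * meanWorkload (c k) (π n))
              atTop) := by
  refine ⟨fun α hα hrate => exists_isMaxWeightSteadyState hα hrate, fun k C hC hCF => ?_⟩
  obtain ⟨E₁, E₂, hE₁, hE₂, hE⟩ := hdesc.exists_mul_meanWorkload_le ⟨0, h0⟩ Amax k hC hCF
  have hb0 := (hdesc.offset_pos k).le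
  have hb : ∀ s ∈ 𝒮, (inner ℝ (c k) (toVec s) : ℝ) ≤ b k := fun s hs =>
    hdesc.inner_le k (toVec_mem_capacityRegion hs)
  refine ⟨?_, fun α v hα hrate hproj hgap hv => ⟨fun π hπ => ?_, fun π hπ => ?_⟩⟩
  · obtain ⟨B, hB, hBeq⟩ := exists_remainder hE₁ hE₂
    refine ⟨B, hB, fun α hα hrate hproj π hπ => ?_⟩
    have hε := hdesc.gap_pos k hrate
    have h := hE α hα hrate hproj π hπ
    rw [hBeq _ hε, ← add_div, ENNReal.ofReal_div_of_pos (by positivity),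
      ENNReal.le_div_iff_mul_le (Or.inl (by simpa using hε)) (Or.inl ENNReal.ofReal_ne_top),
      mul_comm]
    exact h
  -- A squeeze: Kingman's bound for the stationary law from below, the collapse bound from above,
  -- both with limit ζ/2.
  · have hlim := tendsto_of_tendsto_of_tendsto_of_le_of_le (tendsto_lower hv hgap (b k))
      (tendsto_upper hv hgap E₁ E₂)
      (fun n => half_zeta_le (hdesc.gap_pos k (hrate n)).le hb0
        (zeta_le_mul_meanWorkload (hα n) (hrate n) (hπ n).bind_eq (hdesc.norm_eq_one k)
          (hdesc.nonneg k) hb0 hb (hdesc.gap_pos k (hrate n)) (hdesc.gap_eq k (hrate n))))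
      (fun n => (ofReal_mul_eq_half _).trans_le
        (mul_le_mul_right (hE (α n) (hα n) (hrate n) (hproj n) (π n) (hπ n)) _))
    exact ⟨hlim.limsup_eq.le, hlim⟩
  · rw [← (tendsto_lower hv hgap (b k)).liminf_eq]
    exact liminf_le_liminf (Eventually.of_forall fun n =>
      half_zeta_le (hdesc.gap_pos k (hrate n)).le hb0
        ((hπ n).zeta_le (hα n) (hdesc.nonneg k) hb0 hb (hdesc.gap_pos k (hrate n))
          (hdesc.gap_eq k (hrate n))))
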